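/- Let $\mathbb K\in\{\mathbb R,\mathbb C\}$; all Banach spaces are over $\mathbb K$, and an operator is a bounded linear map. For a Banach space $X$, a weak$^*$-compact set $K\subset X^*$ and $\varepsilon>0$, let $s_\varepsilon(K)$ be the set of all $x^*\in K$ such that $\operatorname{diam}(V\cap K)>\varepsilon$ (norm diameter) for every weak$^*$-neighborhood $V$ of $x^*$. Put $s^0_\varepsilon(K)=K$, $s^{\zeta+1}_\varepsilon(K)=s_\varepsilon(s^\zeta_\varepsilon(K))$, and $s^\zeta_\varepsilon(K)=\bigcap_{\eta<\zeta}s^\eta_\varepsilon(K)$ for a limit ordinal $\zeta$; for $\varepsilon\leqslant 0$ put $s^\zeta_\varepsilon(K)=K$ for every $\zeta$. For an ordinal $\xi$ and $1\leqslant q<\infty$, the set $K$ has $\xi$-$q$-summable Szlenk index if there is $M\geqslant 0$ such that for all $n$ and all $\varepsilon_1,\dots,\varepsilon_n\geqslant 0$, $$s^{\omega^\xi}_{\varepsilon_1}\cdots s^{\omega^\xi}_{\varepsilon_n}(K)\neq\varnothing\quad\Longrightarrow\quad\sum_{i=1}^n\varepsilon_i^q\leqslant M^q .$$ An operator $A:X\to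 Y$ has $\xi$-$q$-summable Szlenk index if the set $A^*B_{Y^*}$ does, where $B_{Y^*}$ is the closed unit ball of $Y^*$. The injective tensor product $X\hat\otimes_\varepsilon Y$ is the closed linear span, in the space of operators $Y^*\to X$ with the operator norm, of the operators $x\otimes y:y^*\mapsto y^*(y)x$. For operators $A_i:X_i\to Y_i$, $i=0,1$, the induced operator $A_0\otimes A_1:X_0\hat\otimes_\varepsilon X_1\to Y_0\hat\otimes_\varepsilon Y_1$ is given by $(A_0\otimes A_1)(u)=A_0uA_1^*$. **Corollary.** Let $\xi$ be an ordinal, let $1\leqslant q<\infty$, and let $A_0:X_0\to Y_0$ and $A_1:X_1\to Y_1$ be operators between Banach spaces. If $A_0$ and $A_1$ have $\xi$-$q$-summable Szlenk index, then so does $A_0\otimes A_1:X_0\hat\otimes_\varepsilon X_1\to Y_0\hat\otimes_\varepsilon Y_1$. -/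

import Mathlib

open scoped Ordinal Topology

noncomputable section

namespace Szlenk

section Derivations

variable {𝕜 : Type*} [RCLike 𝕜]
variable {X : Type*} [NormedAddCommGroup X] [NormedSpace 𝕜 X]
variable {Y : Type*} [NormedAddCommGroup Y] [NormedSpace 𝕜 Y]

/-- The Szlenk derivation `s_ε(K)`, for `ε > 0`: the points `x` of `K` such that every
weak* neighbourhood `V` of `x` satisfies `diam (V ∩ K) > ε`, where the diameter is taken with
respect to the norm of the dual space. -/
def pointDeriv (ε : ℝ) (K : Set (WeakDual 𝕜 X)) : Set (WeakDual 𝕜 X) :=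
  {x ∈ K | ∀ V ∈ 𝓝 x,
    ENNReal.ofReal ε < Metric.ediam (WeakDual.toStrongDual '' (V ∩ K))}

/-- The transfinite Szlenk derivation `s_ε^ξ(K)`, with the convention `s_ε^ξ(K) = K` for
`ε ≤ 0`. -/
def iterDeriv (ε : ℝ) (ξ : Ordinal) (K : Set (WeakDual 𝕜 X)) : Set (WeakDual 𝕜 X) :=
  if ε ≤ 0 then K
  else Ordinal.limitRecOn ξ K (fun _ L => pointDeriv ε L)
    (fun ζ _ L => ⋂ (η : Ordinal) (h : η < ζ), L η h)

/-- `multiDeriv ξ [ε₁, …, εₙ] K` is `s_{ε₁}^{ω^ξ} … s_{εₙ}^{ω^ξ}(K)`. -/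
def multiDeriv (ξ : Ordinal) (l : List ℝ) (K : Set (WeakDual 𝕜 X)) : Set (WeakDual 𝕜 X) :=
  l.foldr (fun ε L => iterDeriv ε (ω ^ ξ) L) K

/-- `K` has `M`-`ξ`-`q`-summable Szlenk index. -/
def SetSummableWith (M : ℝ) (ξ : Ordinal) (q : ℝ) (K : Set (WeakDual 𝕜 X)) : Prop :=
  ∀ l : List ℝ, (∀ ε ∈ l, 0 ≤ ε) → (multiDeriv ξ l K).Nonempty →
    (l.map fun ε => ε ^ q).sum ≤ M ^ q

/-- `K` has `ξ`-`q`-summable Szlenk index. -/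
def SetSummable (ξ : Ordinal) (q : ℝ) (K : Set (WeakDual 𝕜 X)) : Prop :=
  ∃ M : ℝ, 0 ≤ M ∧ SetSummableWith M ξ q K

/-- The set `A^* B_{Y^*}`, image of the closed unit ball of `Y^*` under the adjoint
`y^* ↦ y^* ∘ A` of `A`. -/
def adjointBall (A : X →L[𝕜] Y) : Set (WeakDual 𝕜 X) :=
  (fun y : StrongDual 𝕜 Y => StrongDual.toWeakDual (y.comp A)) '' Metric.closedBall 0 1

/-- The operator `A` has `ξ`-`q`-summable Szlenk index. -/
def OperatorSummable (ξ : Ordinal) (q : ℝ) (A : X →L[𝕜] Y) : Prop :=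
  SetSummable ξ q (adjointBall A)

end Derivations

section InjectiveTensorProduct

/-- The normed space `𝔏(E, F)` of bounded operators, with the operator norm. -/
abbrev Op (𝕜 E F : Type*) [RCLike 𝕜] [NormedAddCommGroup E] [NormedSpace 𝕜 E]
    [NormedAddCommGroup F] [NormedSpace 𝕜 F] := E →L[𝕜] F

variable {𝕜 : Type*} [RCLike 𝕜]

section

variable {X Y : Type*} [NormedAddCommGroup X] [NormedSpace 𝕜 X]
  [NormedAddCommGroup Y] [NormedSpace 𝕜 Y]

/-- The elementary tensor `x ⊗ y : Y^* → X`, `y^* ↦ y^*(y) x`. -/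
def elemTensor (x : X) (y : Y) : Op 𝕜 (StrongDual 𝕜 Y) X :=
  (ContinuousLinearMap.apply 𝕜 𝕜 y).smulRight x

theorem elemTensor_apply (x : X) (y : Y) (f : StrongDual 𝕜 Y) :
    elemTensor x y f = f y • x := rfl

end

variable (𝕜) in
/-- The injective tensor product of `X` and `Y`: the closed span, in the space of bounded
operators `Y^* → X` with the operator norm, of the elementary tensors. -/
def InjTensor (X Y : Type*) [NormedAddCommGroup X] [NormedSpace 𝕜 X]
    [NormedAddCommGroup Y] [NormedSpace 𝕜 Y] : Submodule 𝕜 (Op 𝕜 (StrongDual 𝕜 Y) X) :=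
  (Submodule.span 𝕜 (Set.range fun p : X × Y => elemTensor p.1 p.2)).topologicalClosure

variable {X₀ X₁ Y₀ Y₁ : Type*}
  [NormedAddCommGroup X₀] [NormedSpace 𝕜 X₀] [NormedAddCommGroup X₁] [NormedSpace 𝕜 X₁]
  [NormedAddCommGroup Y₀] [NormedSpace 𝕜 Y₀] [NormedAddCommGroup Y₁] [NormedSpace 𝕜 Y₁]

/-- The map `u ↦ A₀ u A₁^*` on bounded operators. -/
def sandwich (A₀ : X₀ →L[𝕜] Y₀) (A₁ : X₁ →L[𝕜] Y₁) :
    Op 𝕜 (Op 𝕜 (StrongDual 𝕜 X₁) X₀) (Op 𝕜 (StrongDual 𝕜 Y₁) Y₀) :=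
  (A₀.postcomp (StrongDual 𝕜 Y₁)).comp
    ((A₁.precomp 𝕜 : Op 𝕜 (StrongDual 𝕜 Y₁) (StrongDual 𝕜 X₁)).precomp X₀)

theorem sandwich_apply (A₀ : X₀ →L[𝕜] Y₀) (A₁ : X₁ →L[𝕜] Y₁)
    (u : Op 𝕜 (StrongDual 𝕜 X₁) X₀) (f : StrongDual 𝕜 Y₁) :
    sandwich A₀ A₁ u f = A₀ (u (f.comp A₁)) := rfl

theorem sandwich_elemTensor (A₀ : X₀ →L[𝕜] Y₀) (A₁ : X₁ →L[𝕜] Y₁) (x : X₀) (y : X₁) :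
    sandwich A₀ A₁ (elemTensor x y) = elemTensor (A₀ x) (A₁ y) := by
  ext f
  simp [sandwich_apply, elemTensor_apply]

theorem sandwich_mem (A₀ : X₀ →L[𝕜] Y₀) (A₁ : X₁ →L[𝕜] Y₁) :
    ∀ u ∈ InjTensor 𝕜 X₀ X₁, sandwich A₀ A₁ u ∈ InjTensor 𝕜 Y₀ Y₁ := by
  intro u hu
  refine map_mem_closure (sandwich A₀ A₁).continuous hu ?_
  intro v hv
  have h : Submodule.span 𝕜 (Set.range fun p : X₀ × X₁ => elemTensor p.1 p.2) ≤
      (Submodule.span 𝕜 (Set.range fun p : Y₀ × Y₁ => elemTensor p.1 p.2)).comap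
        (sandwich A₀ A₁).toLinearMap := by
    rw [Submodule.span_le]
    rintro _ ⟨p, rfl⟩
    refine Submodule.subset_span ⟨(A₀ p.1, A₁ p.2), ?_⟩
    exact (sandwich_elemTensor A₀ A₁ p.1 p.2).symm
  exact h hv

/-- The induced operator `A₀ ⊗ A₁`, `u ↦ A₀ u A₁^*`, between injective tensor products. -/
def tensorOp (A₀ : X₀ →L[𝕜] Y₀) (A₁ : X₁ →L[𝕜] Y₁) :
    Op 𝕜 (InjTensor 𝕜 X₀ X₁) (InjTensor 𝕜 Y₀ Y₁) :=
  ((sandwich A₀ A₁).comp (InjTensor 𝕜 X₀ X₁).subtypeL).codRestrict (InjTensor 𝕜 Y₀ Y₁)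
    fun u => sandwich_mem A₀ A₁ u u.2

end InjectiveTensorProduct

end Szlenk

end

namespace Szlenk

open Set Filter RCLike

/-! ### Transfinite iteration of set operations -/

section Iteration

variable {Z : Type*}

/-! Let `T` be the product of the two weak*-compact dual balls, mapped weak*-continuously by `Φ =
tensorMap A₀ A₁` into the dual of the injective tensor product. The set to be derived lies in the
weak*-closed convex hull of `Φ(T)`. On `T` the function `κ (d₀ + d₁)` dominates the norm distance
between images, and deriving a rectangle derives one of its sides (`powDeriv_prod`), so on `T` the
two hypotheses simply add up. The difficulty is to pass from `T` to the convex hull.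

For this, sets are replaced by functions. A finite family of weighted closed sets gives a function
`f` on `T`, and `envelope Φ S r` is where the upper affine envelope of `f` is at least `r`; the hull
itself is the case `f = 0`, `r = 0`. Deriving an envelope at level `ε` raises `r` by about `a ε /
2`, at the price of adding `a b` to `f` on the `b`-derivatives of its sets (`powDeriv_envelope`).
For one derivation this is a perturbation of the dominating affine function by a vector almost
annihilating a finite net; at successors it follows by averaging many steps with the small
coefficient `a / n`, at limits by compactness.

With `a = ε ^ (q - 1)`, the successive derivations raise `r` to about a quarter of the sum of the `ε
^ q`. A nonempty envelope forces a weight at least `r` on a nonempty derived subset of `T`, while by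
`rpow_sub_one_mul_le` that weight is at most an eighth of the same sum plus a multiple of the sum of
the `b ^ q`, which is bounded on `T`. The eighth is absorbed. -/

/-- The transfinite iteration of an operation `D` on sets, with intersections at limits. -/
noncomputable def transIter (D : Set Z → Set Z) (ζ : Ordinal) (A : Set Z) : Set Z :=
  Ordinal.limitRecOn ζ A (fun _ L => D L) (fun ζ _ L => ⋂ (η : Ordinal) (h : η < ζ), L η h)

@[simp]
theorem transIter_zero (D : Set Z → Set Z) (A : Set Z) : transIter D 0 A = A :=
  Ordinal.limitRecOn_zero _ _ _

theorem transIter_add_one (D : Set Z → Set Z) (ζ : Ordinal) (A : Set Z) :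
    transIter D (ζ + 1) A = D (transIter D ζ A) :=
  Ordinal.limitRecOn_add_one _ _ _ _

theorem transIter_limit (D : Set Z → Set Z) {ζ : Ordinal} (hζ : Order.IsSuccLimit ζ)
    (A : Set Z) : transIter D ζ A = ⋂ (η : Ordinal) (_ : η < ζ), transIter D η A :=
  Ordinal.limitRecOn_limit _ _ _ _ hζ

theorem transIter_antitone {D : Set Z → Set Z} (hD : ∀ A, D A ⊆ A) (A : Set Z) :
    ∀ {ζ η : Ordinal}, η ≤ ζ → transIter D ζ A ⊆ transIter D η A := by
  intro ζ
  induction ζ using Ordinal.limitRecOn with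
  | zero =>
    intro η h
    rw [le_antisymm h zero_le]
  | add_one ζ ih =>
    intro η h
    rcases h.eq_or_lt with rfl | h
    · rfl
    · rw [transIter_add_one]
      exact (hD _).trans (ih (Order.lt_add_one_iff.1 h))
  | limit ζ hζ _ =>
    intro η h
    rcases h.eq_or_lt with rfl | h
    · rfl
    · rw [transIter_limit D hζ]
      exact iInter₂_subset η h

theorem transIter_subset {D : Set Z → Set Z} (hD : ∀ A, D A ⊆ A) (ζ : Ordinal) (A : Set Z) :
    transIter D ζ A ⊆ A := by
  simpa using transIter_antitone hD A (zero_le : 0 ≤ ζ)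

theorem transIter_mono {D D' : Set Z → Set Z} (h : ∀ A B, A ⊆ B → D A ⊆ D' B) (ζ : Ordinal) :
    ∀ {A B : Set Z}, A ⊆ B → transIter D ζ A ⊆ transIter D' ζ B := by
  intro A B hAB
  induction ζ using Ordinal.limitRecOn with
  | zero => simpa using hAB
  | add_one ζ ih =>
    rw [transIter_add_one, transIter_add_one]
    exact h _ _ ih
  | limit ζ hζ ih =>
    rw [transIter_limit D hζ, transIter_limit D' hζ]
    exact iInter₂_mono ih

theorem transIter_id (ζ : Ordinal) (A : Set Z) : transIter (fun B => B) ζ A = A := by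
  induction ζ using Ordinal.limitRecOn with
  | zero => simp
  | add_one ζ ih => rw [transIter_add_one, ih]
  | limit ζ hζ ih =>
    rw [transIter_limit _ hζ]
    refine Subset.antisymm ?_ (subset_iInter₂ fun η hη => (ih η hη).ge)
    refine (iInter₂_subset 0 hζ.bot_lt).trans ?_
    simp

theorem isClosed_transIter [TopologicalSpace Z] {D : Set Z → Set Z}
    (hD : ∀ A, IsClosed A → IsClosed (D A)) (ζ : Ordinal) {A : Set Z} (hA : IsClosed A) :
    IsClosed (transIter D ζ A) := by
  induction ζ using Ordinal.limitRecOn with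
  | zero => simpa using hA
  | add_one ζ ih => simpa [transIter_add_one] using hD _ ih
  | limit ζ hζ ih =>
    rw [transIter_limit D hζ]
    exact isClosed_biInter ih

/-- At a limit, a point lost by `A` at one stage and by `B` at another is lost by both at the larger
stage. -/
theorem transIter_union [TopologicalSpace Z] {D : Set Z → Set Z} (hsub : ∀ A, D A ⊆ A)
    (hmono : ∀ A B, A ⊆ B → D A ⊆ D B) (hcl : ∀ A, IsClosed A → IsClosed (D A))
    (hun : ∀ A B, IsClosed A → IsClosed B → D (A ∪ B) ⊆ D A ∪ D B) (ζ : Ordinal)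
    {A B : Set Z} (hA : IsClosed A) (hB : IsClosed B) :
    transIter D ζ (A ∪ B) ⊆ transIter D ζ A ∪ transIter D ζ B := by
  induction ζ using Ordinal.limitRecOn with
  | zero => simp
  | add_one ζ ih =>
    simp only [transIter_add_one]
    exact (hmono _ _ ih).trans
      (hun _ _ (isClosed_transIter hcl ζ hA) (isClosed_transIter hcl ζ hB))
  | limit ζ hζ ih =>
    simp only [transIter_limit D hζ]
    intro x hx
    by_contra hxn
    simp only [mem_union, mem_iInter, not_or, not_forall] at hxn hx
    obtain ⟨⟨η₁, h₁, hx₁⟩, η₂, h₂, hx₂⟩ := hxn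
    rcases ih _ (max_lt h₁ h₂) (hx _ (max_lt h₁ h₂)) with h | h
    · exact hx₁ (transIter_antitone hsub A (le_max_left _ _) h)
    · exact hx₂ (transIter_antitone hsub B (le_max_right _ _) h)

theorem transIter_add {D : Set Z → Set Z} (hD : ∀ A, D A ⊆ A) (ζ η : Ordinal) (A : Set Z) :
    transIter D (ζ + η) A = transIter D η (transIter D ζ A) := by
  induction η using Ordinal.limitRecOn with
  | zero => simp
  | add_one η ih => rw [← add_assoc, transIter_add_one, transIter_add_one, ih]
  | limit η hη ih =>
    rw [transIter_limit D hη, transIter_limit D (Ordinal.isSuccLimit_add ζ hη)]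
    apply Subset.antisymm
    · refine subset_iInter₂ fun ν hν => ?_
      rw [← ih ν hν]
      exact iInter₂_subset (ζ + ν) (by gcongr)
    · refine subset_iInter₂ fun μ hμ => ?_
      obtain ⟨ν, hν, h⟩ := (Ordinal.lt_add_iff_of_isSuccLimit hη).1 hμ
      refine (iInter₂_subset ν hν).trans ?_
      rw [← ih ν hν]
      exact transIter_antitone hD A h.le

theorem transIter_mul_nat {D : Set Z → Set Z} (hD : ∀ A, D A ⊆ A) (ζ : Ordinal) (n : ℕ)
    (A : Set Z) : transIter D (ζ * n) A = (transIter D ζ)^[n] A := by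
  induction n generalizing A with
  | zero => simp
  | succ n ih =>
    rw [Function.iterate_succ_apply, ← ih, ← transIter_add hD]
    rw [Nat.add_comm n 1, Nat.cast_add, Nat.cast_one, mul_add, mul_one]

theorem transIter_opow_add_one {D : Set Z → Set Z} (hD : ∀ A, D A ⊆ A) (ξ : Ordinal)
    (A : Set Z) :
    transIter D (ω ^ (ξ + 1)) A = ⋂ n : ℕ, (transIter D (ω ^ ξ))^[n] A := by
  have hω : (0 : Ordinal) < ω ^ ξ := Ordinal.opow_pos ξ Ordinal.omega0_pos
  have hl := Ordinal.isSuccLimit_mul_right hω Ordinal.isSuccLimit_omega0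
  rw [← Order.succ_eq_add_one, Ordinal.opow_succ, transIter_limit D hl]
  apply Subset.antisymm
  · refine subset_iInter fun n => ?_
    rw [← transIter_mul_nat hD]
    exact iInter₂_subset (ω ^ ξ * n) (by gcongr; exact Ordinal.natCast_lt_omega0 n)
  · refine subset_iInter₂ fun μ hμ => ?_
    obtain ⟨ν, hν, h⟩ := (Ordinal.lt_mul_iff_of_isSuccLimit Ordinal.isSuccLimit_omega0).1 hμ
    obtain ⟨n, rfl⟩ := Ordinal.lt_omega0.1 hν
    refine (iInter_subset _ n).trans ?_
    rw [← transIter_mul_nat hD]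
    exact transIter_antitone hD A h.le

theorem transIter_opow_limit {D : Set Z → Set Z} (hD : ∀ A, D A ⊆ A) {ξ : Ordinal}
    (hξ : Order.IsSuccLimit ξ) (A : Set Z) :
    transIter D (ω ^ ξ) A = ⋂ η : Iio ξ, transIter D (ω ^ (η : Ordinal)) A := by
  rw [transIter_limit D (Ordinal.isSuccLimit_opow Ordinal.one_lt_omega0 hξ)]
  apply Subset.antisymm
  · refine subset_iInter fun η => iInter₂_subset (ω ^ (η : Ordinal)) ?_
    exact (Ordinal.opow_lt_opow_iff_right Ordinal.one_lt_omega0).2 η.2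
  · refine subset_iInter₂ fun μ hμ => ?_
    obtain ⟨ν, hν, h⟩ :=
      (Ordinal.lt_opow_of_isSuccLimit Ordinal.omega0_ne_zero hξ).1 hμ
    exact (iInter_subset _ (⟨ν, hν⟩ : Iio ξ)).trans (transIter_antitone hD A h.le)

end Iteration

/-! ### A closed derivation for an arbitrary distance function -/

section ClosedDerivation

variable {Z : Type*} [TopologicalSpace Z]

/-- The closed derivation associated with `d`: the closure, within `A`, of the set of points `x`
of `A` that are limits of points `y` of `A` with `d x y > ε`. It does nothing if `ε ≤ 0`. -/
def clDeriv (d : Z → Z → ℝ) (ε : ℝ) (A : Set Z) : Set Z :=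
  {x ∈ A | ε ≤ 0 ∨ x ∈ closure {x ∈ A | ∀ V ∈ 𝓝 x, ∃ y ∈ V ∩ A, ε < d x y}}

variable {d : Z → Z → ℝ}

theorem clDeriv_subset (ε : ℝ) (A : Set Z) : clDeriv d ε A ⊆ A := sep_subset _ _

theorem clDeriv_of_nonpos {ε : ℝ} (hε : ε ≤ 0) : clDeriv d ε = fun A => A := by
  funext A
  simp [clDeriv, hε]

theorem clDeriv_mono {ε ε' : ℝ} (hε : ε' ≤ ε) (A B : Set Z) (h : A ⊆ B) :
    clDeriv d ε A ⊆ clDeriv d ε' B := by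
  rintro x ⟨hx, hx'⟩
  refine ⟨h hx, hx'.imp hε.trans fun hc => closure_mono ?_ hc⟩
  rintro z ⟨hz, hz'⟩
  refine ⟨h hz, fun V hV => ?_⟩
  obtain ⟨y, hy, hd⟩ := hz' V hV
  exact ⟨y, ⟨hy.1, h hy.2⟩, hε.trans_lt hd⟩

/-- The closure built into `clDeriv` gives this with no semicontinuity of `d`; the later compactness
arguments rely on it. -/
theorem isClosed_clDeriv (ε : ℝ) (A : Set Z) (hA : IsClosed A) : IsClosed (clDeriv d ε A) := by
  rcases le_or_gt ε 0 with h | h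
  · simpa [clDeriv_of_nonpos h] using hA
  · simp only [clDeriv, h.not_ge, false_or]
    exact hA.inter isClosed_closure

theorem clDeriv_union (ε : ℝ) (A B : Set Z) (hA : IsClosed A) (hB : IsClosed B) :
    clDeriv d ε (A ∪ B) ⊆ clDeriv d ε A ∪ clDeriv d ε B := by
  rcases le_or_gt ε 0 with h | h
  · simp [clDeriv_of_nonpos h]
  rintro x ⟨-, hx⟩
  replace hx := hx.resolve_left h.not_ge
  have key : {x ∈ A ∪ B | ∀ V ∈ 𝓝 x, ∃ y ∈ V ∩ (A ∪ B), ε < d x y} ⊆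
      {x ∈ A | ∀ V ∈ 𝓝 x, ∃ y ∈ V ∩ A, ε < d x y} ∪
        {x ∈ B | ∀ V ∈ 𝓝 x, ∃ y ∈ V ∩ B, ε < d x y} := by
    rintro z ⟨-, hz⟩
    have hor : (∀ V ∈ 𝓝 z, ∃ y ∈ V ∩ A, ε < d z y) ∨ (∀ V ∈ 𝓝 z, ∃ y ∈ V ∩ B, ε < d z y) := by
      by_contra! hcon
      obtain ⟨⟨V, hV, hVA⟩, V', hV', hVB⟩ := hcon
      obtain ⟨y, ⟨⟨hy, hy'⟩, hyA | hyB⟩, hd⟩ := hz _ (inter_mem hV hV')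
      · exact (hVA y ⟨hy, hyA⟩).not_gt hd
      · exact (hVB y ⟨hy', hyB⟩).not_gt hd
    refine hor.imp (fun hV => ⟨?_, hV⟩) (fun hV => ⟨?_, hV⟩)
    · refine hA.closure_subset (mem_closure_iff_nhds.2 fun V hVn => ?_)
      obtain ⟨y, hy, -⟩ := hV V hVn
      exact ⟨y, hy⟩
    · refine hB.closure_subset (mem_closure_iff_nhds.2 fun V hVn => ?_)
      obtain ⟨y, hy, -⟩ := hV V hVn
      exact ⟨y, hy⟩
  have := closure_mono key hx
  rw [closure_union] at this
  refine this.imp (fun hc => ⟨?_, Or.inr hc⟩) (fun hc => ⟨?_, Or.inr hc⟩)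
  · exact closure_minimal (sep_subset _ _) hA hc
  · exact closure_minimal (sep_subset _ _) hB hc

/-- The derivation `clDeriv d ε` iterated `ω ^ ξ` times. -/
noncomputable def powDeriv (d : Z → Z → ℝ) (ξ : Ordinal) (ε : ℝ) (A : Set Z) : Set Z :=
  transIter (clDeriv d ε) (ω ^ ξ) A

/-- The successive derivations `powDeriv d ξ ε` for `ε` in a list, the last one first. -/
noncomputable def listDeriv (d : Z → Z → ℝ) (ξ : Ordinal) (l : List ℝ) (A : Set Z) : Set Z :=
  l.foldr (fun ε L => powDeriv d ξ ε L) A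

theorem powDeriv_subset (ξ : Ordinal) (ε : ℝ) (A : Set Z) : powDeriv d ξ ε A ⊆ A :=
  transIter_subset (clDeriv_subset ε) _ A

theorem powDeriv_of_nonpos (ξ : Ordinal) {ε : ℝ} (hε : ε ≤ 0) (A : Set Z) :
    powDeriv d ξ ε A = A := by
  rw [powDeriv, clDeriv_of_nonpos hε, transIter_id]

theorem powDeriv_mono (ξ : Ordinal) {ε ε' : ℝ} (hε : ε' ≤ ε) {A B : Set Z} (h : A ⊆ B) :
    powDeriv d ξ ε A ⊆ powDeriv d ξ ε' B :=
  transIter_mono (clDeriv_mono hε) _ h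

theorem isClosed_powDeriv (ξ : Ordinal) (ε : ℝ) {A : Set Z} (hA : IsClosed A) :
    IsClosed (powDeriv d ξ ε A) :=
  isClosed_transIter (isClosed_clDeriv ε) _ hA

theorem powDeriv_union (ξ : Ordinal) (ε : ℝ) {A B : Set Z} (hA : IsClosed A)
    (hB : IsClosed B) : powDeriv d ξ ε (A ∪ B) ⊆ powDeriv d ξ ε A ∪ powDeriv d ξ ε B :=
  transIter_union (clDeriv_subset ε) (clDeriv_mono le_rfl) (isClosed_clDeriv ε)
    (clDeriv_union ε) _ hA hB

theorem powDeriv_zero (ε : ℝ) (A : Set Z) : powDeriv d 0 ε A = clDeriv d ε A := by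
  rw [powDeriv, Ordinal.opow_zero, ← zero_add (1 : Ordinal), transIter_add_one, transIter_zero]

theorem powDeriv_add_one (ξ : Ordinal) (ε : ℝ) (A : Set Z) :
    powDeriv d (ξ + 1) ε A = ⋂ n : ℕ, (powDeriv d ξ ε)^[n] A :=
  transIter_opow_add_one (clDeriv_subset ε) ξ A

theorem powDeriv_limit {ξ : Ordinal} (hξ : Order.IsSuccLimit ξ) (ε : ℝ) (A : Set Z) :
    powDeriv d ξ ε A = ⋂ η : Iio ξ, powDeriv d η ε A :=
  transIter_opow_limit (clDeriv_subset ε) hξ A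

theorem powDeriv_antitone {ξ ξ' : Ordinal} (h : ξ' ≤ ξ) (ε : ℝ) (A : Set Z) :
    powDeriv d ξ ε A ⊆ powDeriv d ξ' ε A :=
  transIter_antitone (clDeriv_subset ε) A (Ordinal.opow_le_opow_right Ordinal.omega0_pos h)

theorem isClosed_iterate_powDeriv (ξ : Ordinal) (ε : ℝ) (n : ℕ) {A : Set Z}
    (hA : IsClosed A) : IsClosed ((powDeriv d ξ ε)^[n] A) := by
  induction n with
  | zero => exact hA
  | succ n ih =>
    rw [Function.iterate_succ_apply']
    exact isClosed_powDeriv ξ ε ih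

theorem iterate_powDeriv_antitone (ξ : Ordinal) (ε : ℝ) (A : Set Z) :
    Antitone fun n : ℕ => (powDeriv d ξ ε)^[n] A := by
  refine antitone_nat_of_succ_le fun n => ?_
  rw [Function.iterate_succ_apply']
  exact powDeriv_subset _ _ _

theorem iterate_powDeriv_union (ξ : Ordinal) (ε : ℝ) (n : ℕ) {A B : Set Z} (hA : IsClosed A)
    (hB : IsClosed B) :
    (powDeriv d ξ ε)^[n] (A ∪ B) ⊆ (powDeriv d ξ ε)^[n] A ∪ (powDeriv d ξ ε)^[n] B := by
  induction n with
  | zero => rfl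
  | succ n ih =>
    simp only [Function.iterate_succ_apply']
    exact (powDeriv_mono ξ le_rfl ih).trans (powDeriv_union ξ ε
      (isClosed_iterate_powDeriv ξ ε n hA) (isClosed_iterate_powDeriv ξ ε n hB))

theorem iterate_powDeriv_mono (ξ : Ordinal) (ε : ℝ) (n : ℕ) {A B : Set Z} (h : A ⊆ B) :
    (powDeriv d ξ ε)^[n] A ⊆ (powDeriv d ξ ε)^[n] B := by
  induction n with
  | zero => exact h
  | succ n ih =>
    simp only [Function.iterate_succ_apply']
    exact powDeriv_mono ξ le_rfl ih

theorem listDeriv_cons (ξ : Ordinal) (ε : ℝ) (l : List ℝ) (A : Set Z) :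
    listDeriv d ξ (ε :: l) A = powDeriv d ξ ε (listDeriv d ξ l A) := rfl

theorem listDeriv_append (ξ : Ordinal) (l l' : List ℝ) (A : Set Z) :
    listDeriv d ξ (l ++ l') A = listDeriv d ξ l (listDeriv d ξ l' A) := by
  simp [listDeriv]

theorem listDeriv_mono (ξ : Ordinal) (l : List ℝ) {A B : Set Z} (h : A ⊆ B) :
    listDeriv d ξ l A ⊆ listDeriv d ξ l B := by
  induction l with
  | nil => exact h
  | cons ε l ih => exact powDeriv_mono ξ le_rfl ih

theorem isClosed_listDeriv (ξ : Ordinal) (l : List ℝ) {A : Set Z} (hA : IsClosed A) :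
    IsClosed (listDeriv d ξ l A) := by
  induction l with
  | nil => exact hA
  | cons ε l ih => exact isClosed_powDeriv ξ ε ih

theorem listDeriv_union (ξ : Ordinal) (l : List ℝ) {A B : Set Z} (hA : IsClosed A)
    (hB : IsClosed B) : listDeriv d ξ l (A ∪ B) ⊆ listDeriv d ξ l A ∪ listDeriv d ξ l B := by
  induction l with
  | nil => rfl
  | cons ε l ih =>
    exact (powDeriv_mono ξ le_rfl ih).trans
      (powDeriv_union ξ ε (isClosed_listDeriv ξ l hA) (isClosed_listDeriv ξ l hB))

end ClosedDerivation

/-! ### Derivations of rectangles -/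

section Product

variable {Z₀ Z₁ : Type*} [TopologicalSpace Z₀] [TopologicalSpace Z₁]
variable {d₀ : Z₀ → Z₀ → ℝ} {d₁ : Z₁ → Z₁ → ℝ}

/-- When `κ (d₀ + d₁)` exceeds `ε`, one of `d₀`, `d₁` exceeds `ε / (2 κ)`. -/
theorem clDeriv_prod {κ : ℝ} (hκ : 0 < κ) (ε : ℝ) (A : Set Z₀) (B : Set Z₁) :
    clDeriv (fun p q : Z₀ × Z₁ => κ * (d₀ p.1 q.1 + d₁ p.2 q.2)) ε (A ×ˢ B) ⊆
      clDeriv d₀ (ε / (2 * κ)) A ×ˢ B ∪ A ×ˢ clDeriv d₁ (ε / (2 * κ)) B := by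
  rcases le_or_gt ε 0 with h | h
  · rw [clDeriv_of_nonpos h, clDeriv_of_nonpos (div_nonpos_of_nonpos_of_nonneg h (by positivity))]
    exact subset_union_left
  have h' : 0 < ε / (2 * κ) := by positivity
  rintro x ⟨hxAB, hx⟩
  replace hx := hx.resolve_left h.not_ge
  have key : {x ∈ A ×ˢ B | ∀ V ∈ 𝓝 x, ∃ y ∈ V ∩ A ×ˢ B,
        ε < κ * (d₀ x.1 y.1 + d₁ x.2 y.2)} ⊆
      {x ∈ A | ∀ V ∈ 𝓝 x, ∃ y ∈ V ∩ A, ε / (2 * κ) < d₀ x y} ×ˢ B ∪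
        A ×ˢ {x ∈ B | ∀ V ∈ 𝓝 x, ∃ y ∈ V ∩ B, ε / (2 * κ) < d₁ x y} := by
    rintro ⟨z₀, z₁⟩ ⟨⟨hz₀, hz₁⟩, hz⟩
    have hor : (∀ V ∈ 𝓝 z₀, ∃ y ∈ V ∩ A, ε / (2 * κ) < d₀ z₀ y) ∨
        (∀ V ∈ 𝓝 z₁, ∃ y ∈ V ∩ B, ε / (2 * κ) < d₁ z₁ y) := by
      by_contra! hcon
      obtain ⟨⟨V, hV, hVA⟩, V', hV', hVB⟩ := hcon
      obtain ⟨⟨y₀, y₁⟩, ⟨⟨hy, hy'⟩, hyA, hyB⟩, hd⟩ := hz _ (prod_mem_nhds hV hV')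
      have e₀ := hVA y₀ ⟨hy, hyA⟩
      have e₁ := hVB y₁ ⟨hy', hyB⟩
      have : κ * (d₀ z₀ y₀ + d₁ z₁ y₁) ≤ κ * (ε / (2 * κ) + ε / (2 * κ)) := by gcongr
      have e : κ * (ε / (2 * κ) + ε / (2 * κ)) = ε := by field_simp; norm_num
      rw [e] at this
      exact this.not_gt hd
    exact hor.imp (fun hV => ⟨⟨hz₀, hV⟩, hz₁⟩) (fun hV => ⟨hz₀, hz₁, hV⟩)
  have := closure_mono key hx
  rw [closure_union, closure_prod_eq, closure_prod_eq] at this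
  exact this.imp (fun hc => ⟨⟨hxAB.1, Or.inr hc.1⟩, hxAB.2⟩)
    (fun hc => ⟨hxAB.1, hxAB.2, Or.inr hc.2⟩)

theorem powDeriv_prod {κ : ℝ} (hκ : 0 < κ) (ε : ℝ) (ξ : Ordinal) :
    ∀ {A : Set Z₀} {B : Set Z₁}, IsClosed A → IsClosed B →
    powDeriv (fun p q : Z₀ × Z₁ => κ * (d₀ p.1 q.1 + d₁ p.2 q.2)) ξ ε (A ×ˢ B) ⊆
      powDeriv d₀ ξ (ε / (2 * κ)) A ×ˢ B ∪ A ×ˢ powDeriv d₁ ξ (ε / (2 * κ)) B := by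
  induction ξ using Ordinal.limitRecOn with
  | zero =>
    intro A B _ _
    simp only [powDeriv_zero]
    exact clDeriv_prod hκ ε A B
  | add_one ξ ih =>
    have hn : ∀ (n : ℕ) {A : Set Z₀} {B : Set Z₁}, IsClosed A → IsClosed B →
        ∀ p ∈ (powDeriv (fun p q : Z₀ × Z₁ => κ * (d₀ p.1 q.1 + d₁ p.2 q.2)) ξ ε)^[n] (A ×ˢ B),
        ∃ i j, i + j = n ∧ p.1 ∈ (powDeriv d₀ ξ (ε / (2 * κ)))^[i] A ∧
          p.2 ∈ (powDeriv d₁ ξ (ε / (2 * κ)))^[j] B := by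
      intro n
      induction n with
      | zero => exact fun _ _ p hp => ⟨0, 0, rfl, hp.1, hp.2⟩
      | succ n ihn =>
        intro A B hA hB p hp
        rw [Function.iterate_succ_apply] at hp
        replace hp := iterate_powDeriv_union ξ ε n
          ((isClosed_powDeriv ξ _ hA).prod hB) (hA.prod (isClosed_powDeriv ξ _ hB))
          (iterate_powDeriv_mono ξ ε n (ih hA hB) hp)
        rcases hp with hp | hp
        · obtain ⟨i, j, hij, hi, hj⟩ := ihn (isClosed_powDeriv ξ _ hA) hB p hp
          exact ⟨i + 1, j, by omega, by rwa [Function.iterate_succ_apply], hj⟩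
        · obtain ⟨i, j, hij, hi, hj⟩ := ihn hA (isClosed_powDeriv ξ _ hB) p hp
          exact ⟨i, j + 1, by omega, hi, by rwa [Function.iterate_succ_apply]⟩
    intro A B hA hB p hp
    have hpAB := powDeriv_subset _ _ _ hp
    simp only [powDeriv_add_one, mem_iInter] at hp ⊢
    by_contra hcon
    simp only [mem_union, mem_prod, mem_iInter, hpAB.1, hpAB.2, true_and, and_true, not_or,
      not_forall] at hcon
    obtain ⟨⟨i, hi⟩, j, hj⟩ := hcon
    -- Since `i' + j' = i + j`, either `i ≤ i'` or `j ≤ j'`, so one of the two assumed losses is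
    -- contradicted.
    obtain ⟨i', j', hij, hi', hj'⟩ := hn (i + j) hA hB p (hp (i + j))
    rcases le_total i i' with h | h
    · exact hi (iterate_powDeriv_antitone ξ _ A h hi')
    · exact hj (iterate_powDeriv_antitone ξ _ B (show j ≤ j' by omega) hj')
  | limit ξ hξ ih =>
    intro A B hA hB p hp
    have hpAB := powDeriv_subset _ _ _ hp
    simp only [powDeriv_limit hξ, mem_iInter] at hp ⊢
    by_contra hcon
    simp only [mem_union, mem_prod, mem_iInter, hpAB.1, hpAB.2, true_and, and_true, not_or,
      not_forall] at hcon
    obtain ⟨⟨η₁, hi⟩, η₂, hj⟩ := hcon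
    have hmax : max (η₁ : Ordinal) η₂ < ξ := max_lt η₁.2 η₂.2
    rcases ih _ hmax hA hB (hp ⟨_, hmax⟩) with h | h
    · exact hi (powDeriv_antitone (le_max_left _ _) _ A h.1)
    · exact hj (powDeriv_antitone (le_max_right _ _) _ B h.2)

/-- Each derivation is charged to a single factor, so sums over the list split. The induction
removes the last entry because it acts first on the rectangle. -/
theorem listDeriv_prod {κ : ℝ} (hκ : 0 < κ) (ξ : Ordinal) (f : ℝ → ℝ) (l : List ℝ)
    (hl : ∀ ε ∈ l, 0 ≤ ε) :
    ∀ {A : Set Z₀} {B : Set Z₁}, IsClosed A → IsClosed B →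
    ∀ p ∈ listDeriv (fun p q : Z₀ × Z₁ => κ * (d₀ p.1 q.1 + d₁ p.2 q.2)) ξ l (A ×ˢ B),
    ∃ l₀ l₁ : List ℝ, (∀ ε ∈ l₀, 0 ≤ ε) ∧ (∀ ε ∈ l₁, 0 ≤ ε) ∧
      (l.map fun ε => f (ε / (2 * κ))).sum = (l₀.map f).sum + (l₁.map f).sum ∧
      p.1 ∈ listDeriv d₀ ξ l₀ A ∧ p.2 ∈ listDeriv d₁ ξ l₁ B := by
  induction l using List.reverseRecOn with
  | nil => exact fun _ _ p hp => ⟨[], [], by simp, by simp, by simp, hp.1, hp.2⟩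
  | append_singleton l ε ih =>
    intro A B hA hB p hp
    have hl' : ∀ ε ∈ l, 0 ≤ ε := fun ε h => hl ε (by simp [h])
    have hε : 0 ≤ ε / (2 * κ) := div_nonneg (hl ε (by simp)) (by positivity)
    rw [listDeriv_append] at hp
    replace hp := listDeriv_union ξ l
      ((isClosed_powDeriv ξ _ hA).prod hB) (hA.prod (isClosed_powDeriv ξ _ hB))
      (listDeriv_mono ξ l (powDeriv_prod hκ ε ξ hA hB) hp)
    rcases hp with hp | hp
    · obtain ⟨l₀, l₁, h₀, h₁, hs, hp₀, hp₁⟩ := ih hl' (isClosed_powDeriv ξ _ hA) hB p hp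
      refine ⟨l₀ ++ [ε / (2 * κ)], l₁, ?_, h₁, ?_, ?_, hp₁⟩
      · intro b hb
        rcases List.mem_append.1 hb with hb | hb
        · exact h₀ b hb
        · rwa [List.mem_singleton.1 hb]
      · simp [hs]; ring
      · rwa [listDeriv_append]
    · obtain ⟨l₀, l₁, h₀, h₁, hs, hp₀, hp₁⟩ := ih hl' hA (isClosed_powDeriv ξ _ hB) p hp
      refine ⟨l₀, l₁ ++ [ε / (2 * κ)], h₀, ?_, ?_, hp₀, ?_⟩
      · intro b hb
        rcases List.mem_append.1 hb with hb | hb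
        · exact h₁ b hb
        · rwa [List.mem_singleton.1 hb]
      · simp [hs]; ring
      · rwa [listDeriv_append]

end Product

/-! ### Envelopes, and the effect of one derivation on them -/

section Domination

variable {𝕜 : Type*} [RCLike 𝕜] {E : Type*} [NormedAddCommGroup E] [NormedSpace 𝕜 E]

/-- The norm distance on the dual space. -/
noncomputable def normDist (x y : WeakDual 𝕜 E) : ℝ :=
  ‖WeakDual.toStrongDual x - WeakDual.toStrongDual y‖

theorem exists_re_gt_of_lt_normDist {x y : WeakDual 𝕜 E} {ε : ℝ} (h : ε < normDist x y) :
    ∃ v : E, ‖v‖ ≤ 1 ∧ ε < re (y v - x v) := by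
  rw [normDist, norm_sub_rev] at h
  obtain ⟨v, hv, hlt⟩ := ContinuousLinearMap.exists_lt_apply_of_lt_opNorm _ h
  obtain ⟨c, hc, hcv⟩ := RCLike.exists_norm_eq_mul_self (y v - x v)
  refine ⟨c • v, by rw [norm_smul, hc, one_mul]; exact hv.le, ?_⟩
  rw [map_smul, map_smul, smul_eq_mul, smul_eq_mul, ← mul_sub, ← hcv, RCLike.ofReal_re]
  exact hlt

/-- If `x` is a weak* limit of points `y` at distance more than `ε` from it, then `y - x` is at
least about `ε / 2` at vectors of the unit ball that almost annihilate finitely many functionals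
given in advance. -/
theorem exists_almost_null {x : WeakDual 𝕜 E} {H : Set (WeakDual 𝕜 E)} {ε : ℝ}
    (hx : ∀ V ∈ 𝓝 x, ∃ y ∈ V ∩ H, ε < normDist x y) {ι : Type*} [Finite ι]
    (φ : ι → WeakDual 𝕜 E) {U : Set (WeakDual 𝕜 E)} (hU : U ∈ 𝓝 x) {η : ℝ} (hη : 0 < η) :
    ∃ y ∈ U ∩ H, ∃ v : E, ‖v‖ ≤ 1 ∧ (∀ i, ‖φ i v‖ ≤ η) ∧ ε / 2 - η ≤ re (y v - x v) := by
  classical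
  set l : Filter (WeakDual 𝕜 E) := 𝓝 x ⊓ 𝓟 {y | y ∈ H ∧ ε < normDist x y} with hl
  have hne : l.NeBot := by
    refine inf_principal_neBot_iff.2 fun V hV => ?_
    obtain ⟨y, hy, hd⟩ := hx V hV
    exact ⟨y, hy.1, hy.2, hd⟩
  have hv : ∀ y : WeakDual 𝕜 E, ∃ v : E, ‖v‖ ≤ 1 ∧ (ε < normDist x y → ε < re (y v - x v)) := by
    intro y
    by_cases h : ε < normDist x y
    · obtain ⟨v, h₁, h₂⟩ := exists_re_gt_of_lt_normDist h
      exact ⟨v, h₁, fun _ => h₂⟩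
    · exact ⟨0, by simp, fun h' => absurd h' h⟩
  choose v hv1 hv2 using hv
  -- The values of the `φ i` at the norming vectors `v y` stay in a compact box, hence cluster as
  -- `y` tends to `x`; half the difference of two such vectors with close values is almost
  -- annihilated.
  have hcomp : IsCompact (Set.univ.pi fun i : ι =>
      Metric.closedBall (0 : 𝕜) ‖WeakDual.toStrongDual (φ i)‖) :=
    isCompact_univ_pi fun i => isCompact_closedBall _ _
  have hmem : ∀ y, (fun i => φ i (v y)) ∈ Set.univ.pi fun i : ι =>
      Metric.closedBall (0 : 𝕜) ‖WeakDual.toStrongDual (φ i)‖ := by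
    intro y i _
    rw [mem_closedBall_zero_iff]
    exact (WeakDual.toStrongDual (φ i)).le_of_opNorm_le_of_le le_rfl (hv1 y) |>.trans_eq
      (mul_one _)
  obtain ⟨p, -, hp⟩ := hcomp.exists_mapClusterPt (f := l) (u := fun y i => φ i (v y))
    (tendsto_principal.2 (Eventually.of_forall hmem))
  have hnhd : {f : ι → 𝕜 | ∀ i, ‖f i - p i‖ < η} ∈ 𝓝 p := by
    have : {f : ι → 𝕜 | ∀ i, ‖f i - p i‖ < η} = Set.univ.pi fun i => Metric.ball (p i) η := by
      ext f
      simp [dist_eq_norm]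
    rw [this]
    exact set_pi_mem_nhds Set.finite_univ fun i _ => Metric.ball_mem_nhds _ hη
  have hfreq : ∃ᶠ y in l, ∀ i, ‖φ i (v y) - p i‖ < η := hp.frequently hnhd
  -- `y'` is fixed first; then `y` is taken so close to `x` that `y - x` contributes less than `η`
  -- at `v y'`. Halving the difference costs the factor 2.
  obtain ⟨y', hy'⟩ := hfreq.exists
  have hev : ∀ᶠ y in 𝓝 x, re (y (v y') - x (v y')) < η := by
    have hc : Continuous fun y : WeakDual 𝕜 E => re (y (v y') - x (v y')) :=
      RCLike.continuous_re.comp ((WeakDual.eval_continuous _).sub continuous_const)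
    exact hc.continuousAt.eventually_lt continuousAt_const (by simpa using hη)
  have hev' : ∀ᶠ y in l, (re (y (v y') - x (v y')) < η ∧ y ∈ U) ∧ y ∈ H ∧ ε < normDist x y :=
    ((hev.and hU).filter_mono inf_le_left).and (mem_inf_of_right (mem_principal_self _))
  obtain ⟨y, hy, ⟨hy₁, hyU⟩, hyH, hyd⟩ := (hfreq.and_eventually hev').exists
  have hhalf : ‖(2⁻¹ : 𝕜)‖ = 2⁻¹ := by simp
  refine ⟨y, ⟨hyU, hyH⟩, (2⁻¹ : 𝕜) • (v y - v y'), ?_, fun i => ?_, ?_⟩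
  · rw [norm_smul, hhalf]
    have := (norm_sub_le (v y) (v y')).trans (add_le_add (hv1 y) (hv1 y'))
    linarith
  · rw [map_smul, map_sub, norm_smul, hhalf]
    have := norm_sub_le_norm_sub_add_norm_sub (φ i (v y)) (p i) (φ i (v y'))
    have h₁ := hy i
    have h₂ := hy' i
    rw [norm_sub_rev] at h₂
    linarith
  · have h₁ := hv2 y hyd
    have : re (y ((2⁻¹ : 𝕜) • (v y - v y')) - x ((2⁻¹ : 𝕜) • (v y - v y'))) =
        2⁻¹ * (re (y (v y) - x (v y)) - re (y (v y') - x (v y'))) := by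
      rw [show (2⁻¹ : 𝕜) = ((2⁻¹ : ℝ) : 𝕜) by rw [RCLike.ofReal_inv, RCLike.ofReal_ofNat]]
      simp only [map_smul, map_sub, smul_eq_mul, RCLike.re_ofReal_mul]
      ring
    rw [this]
    linarith

variable {T : Type*}

/-- For a set `S` of pairs `(A, w)`, thought of as the function `f = max {w | t ∈ A}` on `T`, the
set of `x` at which the upper envelope of `f` by affine functions `re (· u) + c` is at
least `r`. -/
def envelope (Φ : T → WeakDual 𝕜 E) (S : Set (Set T × ℝ)) (r : ℝ) : Set (WeakDual 𝕜 E) :=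
  {x | ∀ (u : E) (c : ℝ), (∀ p ∈ S, ∀ t ∈ p.1, p.2 ≤ re (Φ t u) + c) → r ≤ re (x u) + c}

variable {Φ : T → WeakDual 𝕜 E}

theorem isClosed_envelope (S : Set (Set T × ℝ)) (r : ℝ) : IsClosed (envelope Φ S r) := by
  simp only [envelope, ofPred_forall]
  refine isClosed_iInter fun u => isClosed_iInter fun c => isClosed_iInter fun _ => ?_
  exact isClosed_le continuous_const
    ((RCLike.continuous_re.comp (WeakDual.eval_continuous u)).add continuous_const)

theorem envelope_anti (S : Set (Set T × ℝ)) {r r' : ℝ} (h : r' ≤ r) :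
    envelope Φ S r ⊆ envelope Φ S r' :=
  fun _ hx u c hc => h.trans (hx u c hc)

theorem exists_level (A : Set T) {δ : ℝ} (t : T) (J : ℕ) (ht : t ∈ A) (D : ℝ → Set T → Set T)
    (h0 : D 0 A = A) :
    ∃ j ≤ J, t ∈ D (j * δ) A ∧ (j = J ∨ t ∉ D ((j + 1 : ℕ) * δ) A) := by
  induction J with
  | zero => exact ⟨0, le_rfl, by simpa [h0] using ht, Or.inl rfl⟩
  | succ J ih =>
    obtain ⟨j, hj, htj, h⟩ := ih
    by_cases h' : t ∈ D ((j + 1 : ℕ) * δ) A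
    · rcases h with rfl | h
      · exact ⟨j + 1, le_rfl, h', Or.inl rfl⟩
      · exact absurd h' h
    · exact ⟨j, by omega, htj, Or.inr h'⟩

variable [TopologicalSpace T]

/-- The pairs obtained from `(A, w) ∈ S` by deriving `A` at level `j δ`, with a gain
`a j δ`. -/
noncomputable def shift (d : T → T → ℝ) (ξ : Ordinal) (a δ : ℝ) (J : ℕ) (S : Set (Set T × ℝ)) :
    Set (Set T × ℝ) :=
  Set.image2 (fun (p : Set T × ℝ) (j : ℕ) => (powDeriv d ξ (j * δ) p.1, p.2 + a * (j * δ)))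
    S (Set.Iic J)

variable {d : T → T → ℝ}

theorem finite_shift (ξ : Ordinal) (a δ : ℝ) (J : ℕ) {S : Set (Set T × ℝ)} (hS : S.Finite) :
    (shift d ξ a δ J S).Finite :=
  hS.image2 _ (Set.finite_Iic J)

theorem isClosed_of_mem_shift (ξ : Ordinal) (a δ : ℝ) (J : ℕ) {S : Set (Set T × ℝ)}
    (hS : ∀ p ∈ S, IsClosed p.1) : ∀ p ∈ shift d ξ a δ J S, IsClosed p.1 := by
  rintro _ ⟨p, hp, j, -, rfl⟩
  exact isClosed_powDeriv ξ _ (hS p hp)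

theorem envelope_subset_shift (ξ : Ordinal) (a δ : ℝ) (J : ℕ) (S : Set (Set T × ℝ)) (r : ℝ) :
    envelope Φ S r ⊆ envelope Φ (shift d ξ a δ J S) r := by
  intro x hx u c hc
  refine hx u c fun p hp t ht => ?_
  have := hc _ ⟨p, hp, 0, Nat.zero_le J, rfl⟩ t
    (by simpa [powDeriv_of_nonpos ξ (le_refl (0 : ℝ))] using ht)
  simpa using this

/-- Take for `j` a grid level at which `t` survives but not at the next one, which bounds `d t`
nearby; if no such level occurs below `J`, the global bound on `d` suffices. -/
theorem exists_nhds_level {δ : ℝ} (hδ : 0 < δ) {J : ℕ} {A : Set T}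
    (hR : ∀ s t, d s t ≤ J * δ) {t : T} (ht : t ∈ A) :
    ∃ j ≤ J, t ∈ clDeriv d (j * δ) A ∧ ∀ᶠ s in 𝓝 t, s ∈ A → d t s ≤ j * δ + δ := by
  obtain ⟨j, hj, htj, h⟩ := exists_level (δ := δ) A t J ht (fun ε A => clDeriv d ε A)
    (by simp [clDeriv_of_nonpos])
  refine ⟨j, hj, htj, ?_⟩
  rcases h with rfl | h
  · exact Eventually.of_forall fun s _ => (hR t s).trans (by linarith)
  · by_contra hcon
    refine h ⟨ht, Or.inr (subset_closure ⟨ht, fun V hV => ?_⟩)⟩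
    by_contra! hV'
    refine hcon ?_
    filter_upwards [hV] with s hs hsA
    have := hV' s ⟨hs, hsA⟩
    push_cast at this
    linarith

variable [CompactSpace T]

/-- If `(u, c)` dominates the shifted function, then `u - a v` with a slightly larger constant
dominates the original one: subtracting `a v` costs at most about `a * d t s` at `s` near a net
point `t`, which the shift at `t` has paid for. Testing at a nearby `y` of the envelope gains `a *
re (y v)`, about `a ε / 2`. -/
theorem clDeriv_envelope (hΦ : Continuous Φ) (hd : ∀ s t, normDist (Φ s) (Φ t) ≤ d s t)
    {a δ : ℝ} (ha : 0 ≤ a) (hδ : 0 < δ) {J : ℕ} (hR : ∀ s t, d s t ≤ J * δ)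
    {S : Set (Set T × ℝ)} (hS : S.Finite) (hS' : ∀ p ∈ S, IsClosed p.1) {ε : ℝ} (hε : 0 < ε)
    (r : ℝ) :
    clDeriv normDist ε (envelope Φ S r) ⊆
      envelope Φ (shift d 0 a δ J S) (r + a * (ε / 2 - 2 * δ)) := by
  rintro x ⟨-, hx⟩
  replace hx := hx.resolve_left hε.not_ge
  refine closure_minimal ?_ (isClosed_envelope _ _) hx
  clear x hx
  rintro x ⟨-, hx⟩ u c hc
  have hg : Continuous fun t => re (Φ t u) :=
    RCLike.continuous_re.comp ((WeakDual.eval_continuous u).comp hΦ)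
  have hmain : ∀ η : ℝ, 0 < η →
      r + a * (ε / 2 - 2 * δ) ≤ re (x u) + c + η * (2 + 2 * a) := by
    intro η hη
    have hloc : ∀ t, ∀ᶠ s in 𝓝 t, |re (Φ s u) - re (Φ t u)| < η ∧
        ∀ p ∈ S, s ∈ p.1 → p.2 ≤ re (Φ t u) + c - a * d t s + a * δ := by
      intro t
      refine Eventually.and ?_ ((Filter.eventually_all_finite hS).2 fun p hp => ?_)
      · simpa [Real.dist_eq] using hg.continuousAt.eventually (Metric.ball_mem_nhds _ hη)
      · by_cases ht : t ∈ p.1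
        · obtain ⟨j, hj, htj, hev⟩ := exists_nhds_level hδ hR ht
          have hw := hc _ ⟨p, hp, j, hj, rfl⟩ t (by simpa [powDeriv_zero] using htj)
          filter_upwards [hev] with s hs hsp
          have := mul_le_mul_of_nonneg_left (hs hsp) ha
          simp only at hw
          linarith
        · filter_upwards [(hS' p hp).isOpen_compl.mem_nhds ht] with s hs hsp
          exact absurd hsp hs
    obtain ⟨F, -, hF⟩ := isCompact_univ.elim_nhds_subcover _ fun t _ => hloc t
    have hU : {y : WeakDual 𝕜 E | re (y u) < re (x u) + η} ∈ 𝓝 x := by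
      have hc' : Continuous fun y : WeakDual 𝕜 E => re (y u) :=
        RCLike.continuous_re.comp (WeakDual.eval_continuous u)
      exact hc'.continuousAt.eventually_lt continuousAt_const (by linarith)
    -- The index `none` adds `x` to the functionals almost killed by `v`, so that `y v` itself is
    -- bounded below.
    obtain ⟨y, ⟨hyU, hyS⟩, v, hv, hφ, hyv⟩ :=
      exists_almost_null hx (fun i : Option F => i.elim x fun t => Φ t) hU (half_pos hη)
    have hxv : |re (x v)| ≤ η / 2 := (RCLike.abs_re_le_norm _).trans (hφ none)
    have key := hyS (u - (a : 𝕜) • v) (c + η + a * δ + a * (η / 2)) (by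
      intro p hp s hs
      obtain ⟨t, htF, hts⟩ := mem_iUnion₂.1 (hF (mem_univ s))
      have h₁ := hts.2 p hp hs
      have h₂ := (abs_lt.1 hts.1).1
      have h₃ : |re (Φ t v)| ≤ η / 2 := (RCLike.abs_re_le_norm _).trans (hφ (some ⟨t, htF⟩))
      have h₄ : re (Φ s v - Φ t v) ≤ d t s := by
        refine (RCLike.re_le_norm _).trans (le_trans ?_ (hd t s))
        rw [normDist, norm_sub_rev (WeakDual.toStrongDual (Φ t))]
        exact ((WeakDual.toStrongDual (Φ s) - WeakDual.toStrongDual (Φ t)).le_of_opNorm_le_of_le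
          le_rfl hv).trans_eq (mul_one _)
      have h₅ : re (Φ s v) ≤ d t s + η / 2 := by
        rw [map_sub] at h₄
        linarith [(abs_le.1 h₃).2]
      have h₆ := mul_le_mul_of_nonneg_left h₅ ha
      rw [map_sub, map_smul, smul_eq_mul, map_sub, RCLike.re_ofReal_mul]
      linarith)
    rw [map_sub, map_smul, smul_eq_mul, map_sub, RCLike.re_ofReal_mul] at key
    rw [map_sub] at hyv
    have h₇ : ε / 2 - η ≤ re (y v) := by linarith [(abs_le.1 hxv).1]
    have h₈ := mul_le_mul_of_nonneg_left h₇ ha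
    have h₉ : re (y u) < re (x u) + η := hyU
    have h₁₀ : 0 ≤ a * δ := by positivity
    have h₁₁ : 0 ≤ a * η := by positivity
    linarith
  refine le_of_forall_pos_le_add fun η hη => ?_
  have h := hmain (η / (2 + 2 * a)) (by positivity)
  rwa [div_mul_cancel₀ _ (by positivity)] at h

/-- The compact set where `g + η ≤ w` misses the intersection of the decreasing closed sets, hence
misses one of them. -/
theorem eventually_forall_le_add {ι : Type*} [Nonempty ι] [LinearOrder ι] {F : ι → Set T}
    (hF : ∀ i, IsClosed (F i)) (hanti : Antitone F) {g : T → ℝ} (hg : Continuous g) {w : ℝ}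
    (hw : ∀ t ∈ ⋂ i, F i, w ≤ g t) {η : ℝ} (hη : 0 < η) :
    ∀ᶠ i in atTop, ∀ t ∈ F i, w ≤ g t + η := by
  have hK : IsCompact {t | g t + η ≤ w} :=
    (isClosed_le (hg.add continuous_const) continuous_const).isCompact
  obtain ⟨i, hi⟩ := hK.elim_directed_family_closed F hF
    (by
      refine eq_empty_of_forall_notMem fun t ht => ?_
      have h₁ := hw t ht.2
      have h₂ : g t + η ≤ w := ht.1
      linarith) hanti.directed_ge
  filter_upwards [eventually_ge_atTop i] with k hk t ht
  by_contra! hlt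
  exact notMem_empty t (hi ▸ ⟨hlt.le, hanti hk ht⟩)

end Domination

/-! ### Averaging over lists of levels -/

section Averaging

theorem sum_le_countP_mul_add {M k : ℕ} (l : List ℕ) (hl : ∀ j ∈ l, j ≤ M) :
    l.sum ≤ l.countP (fun j => k + 1 ≤ j) * M + l.length * k := by
  induction l with
  | nil => simp
  | cons j l ih =>
    have h₁ := ih fun i hi => hl i (List.mem_cons_of_mem _ hi)
    have h₂ := hl j List.mem_cons_self
    by_cases h : k + 1 ≤ j
    · simp only [List.sum_cons, List.countP_cons, h, decide_true, if_true, List.length_cons]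
      nlinarith
    · simp only [List.sum_cons, List.countP_cons, h, decide_false, List.length_cons]
      simp only [Bool.false_eq_true, if_false]
      nlinarith

/-- In a long list of integers bounded by `2 J` and with average at least `2 j`, many entries are
at least `2 j`. -/
theorem le_countP_of_mul_le_sum {J N j : ℕ} (l : List ℕ) (hl : ∀ i ∈ l, i ≤ 2 * J)
    (hlen : l.length = 2 * J * N + N + 1) (hj : l.length * (2 * j) ≤ l.sum) :
    N ≤ l.countP (fun i => 2 * j ≤ i) := by
  rcases j with - | j
  · simp [hlen]
    omega
  -- With fewer than `N` large entries the sum would be at most `2 J N` plus the length times one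
  -- less than the required average; the length exceeds `2 J N`.
  · have h := sum_le_countP_mul_add (k := 2 * j + 1) l hl
    rw [show 2 * (j + 1) = 2 * j + 1 + 1 by ring] at hj ⊢
    by_contra! hlt
    have h₂ : l.countP (fun i => 2 * j + 1 + 1 ≤ i) * (2 * J) ≤ N * (2 * J) := by gcongr
    have h₃ : l.length * (2 * j + 1 + 1) = l.length * (2 * j + 1) + l.length := by ring
    have h₄ : N * (2 * J) = 2 * J * N := by ring
    omega

variable {T : Type*} [TopologicalSpace T] {d : T → T → ℝ}

/-- Entries below `m` are dropped and the others lowered to `m`; both only enlarge the set. -/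
theorem listDeriv_subset_iterate (ξ : Ordinal) {δ : ℝ} (hδ : 0 ≤ δ) (m : ℕ) (l : List ℕ)
    (A : Set T) :
    listDeriv d ξ (l.map fun j : ℕ => j * δ) A ⊆
      (powDeriv d ξ (m * δ))^[l.countP (fun j => m ≤ j)] A := by
  induction l with
  | nil => simp [listDeriv]
  | cons j l ih =>
    rw [List.map_cons, listDeriv_cons]
    by_cases h : m ≤ j
    · rw [List.countP_cons_of_pos (by simpa using h), Function.iterate_succ_apply']
      exact powDeriv_mono ξ (by gcongr) ih
    · rw [List.countP_cons_of_neg (by simpa using h)]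
      exact (powDeriv_subset _ _ _).trans ih

theorem exists_of_mem_iterate_shift (ξ : Ordinal) (a δ : ℝ) (J : ℕ) (S : Set (Set T × ℝ))
    (n : ℕ) : ∀ p ∈ (shift d ξ a δ J)^[n] S, ∃ p' ∈ S, ∃ l : List ℕ, l.length = n ∧
      (∀ j ∈ l, j ≤ J) ∧ p.1 = listDeriv d ξ (l.map fun j : ℕ => j * δ) p'.1 ∧
      p.2 = p'.2 + a * (l.sum * δ) := by
  induction n with
  | zero => exact fun p hp => ⟨p, hp, [], by simp [listDeriv]⟩
  | succ n ih =>
    intro p hp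
    rw [Function.iterate_succ_apply'] at hp
    obtain ⟨p₁, hp₁, j, hj, rfl⟩ := hp
    obtain ⟨p', hp', l, hlen, hl, h₁, h₂⟩ := ih p₁ hp₁
    refine ⟨p', hp', j :: l, by simp [hlen], ?_, ?_, ?_⟩
    · simpa using ⟨hj, hl⟩
    · simp only [List.map_cons, listDeriv_cons, h₁]
    · simp only [h₂, List.sum_cons, Nat.cast_add]
      ring

end Averaging

/-! ### Transfinite derivations of envelopes -/

section Main

variable {𝕜 : Type*} [RCLike 𝕜] {E : Type*} [NormedAddCommGroup E] [NormedSpace 𝕜 E]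
variable {T : Type*} [TopologicalSpace T] [CompactSpace T]
variable {d : T → T → ℝ} {Φ : T → WeakDual 𝕜 E}

/-- Deriving `ω ^ ξ` times the level sets of an envelope, at level `ε`, increases the level by
about `a ε / 2`, if the function on `T` is increased by `a b` on the derivatives at level `b`
of its level sets. -/
theorem powDeriv_envelope (hΦ : Continuous Φ) (hd : ∀ s t, normDist (Φ s) (Φ t) ≤ d s t)
    (ε : ℝ) (ξ : Ordinal) :
    ∀ {a δ : ℝ}, 0 ≤ a → 0 < δ → ∀ {J : ℕ}, (∀ s t, d s t ≤ J * δ) →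
    ∀ {S : Set (Set T × ℝ)}, S.Finite → (∀ p ∈ S, IsClosed p.1) → ∀ r : ℝ,
    powDeriv normDist ξ ε (envelope Φ S r) ⊆
      envelope Φ (shift d ξ a δ J S) (r + a * (ε / 2 - 2 * δ)) := by
  rcases le_or_gt ε 0 with hε | hε
  · intro a δ ha hδ J _ S _ _ r
    rw [powDeriv_of_nonpos ξ hε]
    refine (envelope_anti S ?_).trans (envelope_subset_shift ξ a δ J S _)
    have := mul_nonpos_of_nonneg_of_nonpos ha (show ε / 2 - 2 * δ ≤ 0 by linarith)
    linarith
  induction ξ using Ordinal.limitRecOn with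
  | zero =>
    intro a δ ha hδ J hR S hS hS' r
    rw [powDeriv_zero]
    exact clDeriv_envelope hΦ hd ha hδ hR hS hS' hε r
  | add_one ξ ih =>
    intro a δ ha hδ J hR S hS hS' r x hx u c hc
    have hg : Continuous fun t => re (Φ t u) + c :=
      (RCLike.continuous_re.comp ((WeakDual.eval_continuous u).comp hΦ)).add continuous_const
    refine le_of_forall_pos_le_add fun η hη => ?_
    have hev : ∀ᶠ N : ℕ in atTop, ∀ p ∈ S, ∀ j ∈ Set.Iic J,
        ∀ t ∈ (powDeriv d ξ (j * δ))^[N] p.1,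
          p.2 + a * (j * δ) ≤ re (Φ t u) + c + η := by
      refine (eventually_all_finite hS).2 fun p hp =>
        (eventually_all_finite (Set.finite_Iic J)).2 fun j hj => ?_
      refine eventually_forall_le_add (fun N => isClosed_iterate_powDeriv ξ _ N (hS' p hp))
        (iterate_powDeriv_antitone ξ _ _) hg (fun t ht => ?_) hη
      rw [← powDeriv_add_one] at ht
      exact hc _ ⟨p, hp, j, hj, rfl⟩ t ht
    obtain ⟨N, hN⟩ := hev.exists
    -- `N` iterations suffice by compactness; this `n` ensures that at least `N` of the `n` levels
    -- reach the rounded average.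
    set n := 2 * J * N + N + 1 with hn
    have hn0 : (0 : ℝ) < n := by positivity
    -- Halving the mesh makes the total error `a δ` rather than `2 a δ`; the remaining `a δ` pays
    -- for rounding the average.
    have hiter : ∀ m : ℕ, (((shift d ξ (a / n) (δ / 2) (2 * J))^[m] S).Finite ∧
        ∀ p ∈ (shift d ξ (a / n) (δ / 2) (2 * J))^[m] S, IsClosed p.1) ∧
        (powDeriv normDist ξ ε)^[m] (envelope Φ S r) ⊆
        envelope Φ ((shift d ξ (a / n) (δ / 2) (2 * J))^[m] S)
          (r + m * (a / n * (ε / 2 - 2 * (δ / 2)))) := by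
      intro m
      induction m with
      | zero => exact ⟨⟨hS, hS'⟩, by simp⟩
      | succ m ihm =>
        obtain ⟨⟨h₁, h₂⟩, h₃⟩ := ihm
        simp only [Function.iterate_succ_apply']
        refine ⟨⟨finite_shift _ _ _ _ h₁, isClosed_of_mem_shift _ _ _ _ h₂⟩, ?_⟩
        refine (powDeriv_mono ξ le_rfl h₃).trans ((ih (by positivity) (half_pos hδ)
          (fun s t => (hR s t).trans_eq (by push_cast; ring)) h₁ h₂ _).trans
          (envelope_anti _ (le_of_eq ?_)))
        push_cast
        ring
    rw [powDeriv_add_one] at hx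
    have key := (hiter n).2 (mem_iInter.1 hx n) u (c + η + a * δ) (by
      intro q hq t ht
      obtain ⟨p, hp, l, hlen, hl, h₁, h₂⟩ := exists_of_mem_iterate_shift _ _ _ _ _ _ q hq
      -- `j * δ` is the average of the levels `i * (δ / 2)`, rounded down to the grid of mesh `δ`.
      set j := l.sum / (2 * n) with hj
      have hsum : l.sum ≤ n * (2 * J) := by
        have := List.sum_le_card_nsmul l (2 * J) hl
        simpa [hlen] using this
      have hjJ : j ≤ J := by
        refine Nat.div_le_of_le_mul ?_
        linarith
      have hj₁ : n * (2 * j) ≤ l.sum := by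
        have := Nat.div_mul_le_self l.sum (2 * n)
        rw [← hj] at this
        linarith
      have hj₂ : l.sum ≤ n * (2 * (j + 1)) := by
        have := (Nat.lt_mul_div_succ l.sum (show 0 < 2 * n by omega)).le
        rw [← hj] at this
        linarith
      have hcount := le_countP_of_mul_le_sum (j := j) l hl (hlen.trans hn)
        (by rw [hlen]; exact hj₁)
      rw [h₁] at ht
      have ht' := iterate_powDeriv_antitone ξ _ _ hcount
        (listDeriv_subset_iterate ξ (half_pos hδ).le (2 * j) l p.1 ht)
      rw [show ((2 * j : ℕ) : ℝ) * (δ / 2) = j * δ by push_cast; ring] at ht'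
      have hfin := hN p hp j hjJ t ht'
      have hj₂' : (l.sum : ℝ) ≤ n * (2 * (j + 1)) := by exact_mod_cast hj₂
      have hle : a / n * (l.sum * (δ / 2)) ≤ a / n * (n * (2 * (j + 1)) * (δ / 2)) := by gcongr
      have heq : a / n * (n * (2 * (j + 1)) * (δ / 2)) = a * (j * δ) + a * δ := by
        field_simp
      rw [h₂]
      linarith)
    have heq : n * (a / n * (ε / 2 - 2 * (δ / 2))) = a * (ε / 2 - 2 * δ) + a * δ := by
      field_simp
      ring
    rw [heq] at key
    linarith
  | limit ξ hξ ih =>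
    intro a δ ha hδ J hR S hS hS' r x hx u c hc
    have hg : Continuous fun t => re (Φ t u) + c :=
      (RCLike.continuous_re.comp ((WeakDual.eval_continuous u).comp hΦ)).add continuous_const
    have : Nonempty (Iio ξ) := ⟨⟨0, hξ.bot_lt⟩⟩
    refine le_of_forall_pos_le_add fun η hη => ?_
    -- Only finitely many pairs `(p, j)` occur, so a single `ν < ξ` serves them all.
    have hev : ∀ᶠ ν : Iio ξ in atTop, ∀ p ∈ S, ∀ j ∈ Set.Iic J,
        ∀ t ∈ powDeriv d ν (j * δ) p.1, p.2 + a * (j * δ) ≤ re (Φ t u) + c + η := by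
      refine (eventually_all_finite hS).2 fun p hp =>
        (eventually_all_finite (Set.finite_Iic J)).2 fun j hj => ?_
      refine eventually_forall_le_add (F := fun ν : Iio ξ => powDeriv d ν (j * δ) p.1)
        (fun ν => isClosed_powDeriv _ _ (hS' p hp))
        (fun _ _ h => powDeriv_antitone h _ _) hg (fun t ht => ?_) hη
      rw [← powDeriv_limit hξ] at ht
      exact hc _ ⟨p, hp, j, hj, rfl⟩ t ht
    obtain ⟨ν, hν⟩ := hev.exists
    rw [powDeriv_limit hξ] at hx
    have key := ih ν ν.2 ha hδ hR hS hS' r (mem_iInter.1 hx ν) u (c + η) (by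
      rintro _ ⟨p, hp, j, hj, rfl⟩ t ht
      have := hν p hp j hj t ht
      simp only
      linarith)
    linarith

end Main

/-! ### Comparison with the Szlenk derivation -/

section Comparison

variable {𝕜 : Type*} [RCLike 𝕜] {E : Type*} [NormedAddCommGroup E] [NormedSpace 𝕜 E]

theorem iterDeriv_of_pos {ε : ℝ} (hε : 0 < ε) (ζ : Ordinal) (K : Set (WeakDual 𝕜 E)) :
    iterDeriv ε ζ K = transIter (pointDeriv ε) ζ K := by
  rw [iterDeriv, if_neg hε.not_ge]
  rfl

/-- A set within `ε / 2` of `x` has diameter at most `ε`; this is where a factor 2 is lost. -/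
theorem pointDeriv_subset_clDeriv (ε : ℝ) (A B : Set (WeakDual 𝕜 E))
    (h : A ⊆ B) : pointDeriv ε A ⊆ clDeriv normDist (ε / 2) B := by
  rintro x ⟨hx, hx'⟩
  refine ⟨h hx, Or.inr (subset_closure ⟨h hx, fun V hV => ?_⟩)⟩
  by_contra! hcon
  refine (hx' V hV).not_ge (Metric.ediam_le ?_)
  rintro _ ⟨y, hy, rfl⟩ _ ⟨z, hz, rfl⟩
  rw [edist_dist, dist_eq_norm]
  refine ENNReal.ofReal_le_ofReal ?_
  have h₁ := hcon y ⟨hy.1, h hy.2⟩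
  have h₂ := hcon z ⟨hz.1, h hz.2⟩
  rw [normDist] at h₁ h₂
  rw [norm_sub_rev] at h₁
  exact (norm_sub_le_norm_sub_add_norm_sub _ (WeakDual.toStrongDual x) _).trans (by linarith)

theorem multiDeriv_subset_listDeriv (ξ : Ordinal) (l : List ℝ) (K : Set (WeakDual 𝕜 E)) :
    multiDeriv ξ l K ⊆ listDeriv normDist ξ (l.map fun ε => ε / 2) K := by
  induction l with
  | nil => rfl
  | cons ε l ih =>
    rw [List.map_cons, listDeriv_cons]
    change iterDeriv ε (ω ^ ξ) (multiDeriv ξ l K) ⊆ _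
    rcases le_or_gt ε 0 with h | h
    · rw [iterDeriv, if_pos h, powDeriv_of_nonpos ξ (by linarith)]
      exact ih
    · rw [iterDeriv_of_pos h]
      exact transIter_mono (pointDeriv_subset_clDeriv ε) _ ih

theorem isClosed_pointDeriv (ε : ℝ) (K : Set (WeakDual 𝕜 E)) (hK : IsClosed K) :
    IsClosed (pointDeriv ε K) := by
  refine isClosed_of_closure_subset fun x hx => ⟨?_, fun V hV => ?_⟩
  · exact closure_minimal (sep_subset _ _) hK hx
  · obtain ⟨U, hUV, hU, hxU⟩ := mem_nhds_iff.1 hV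
    obtain ⟨y, hyU, hy⟩ := mem_closure_iff.1 hx U hU hxU
    exact (hy.2 U (hU.mem_nhds hyU)).trans_le
      (Metric.ediam_mono (image_mono (inter_subset_inter_left _ hUV)))

variable {T : Type*} [TopologicalSpace T] {φ : T → WeakDual 𝕜 E}

/-- No constant is lost in this direction: a point and its distant neighbour already witness the
diameter, and the closure in `clDeriv` is absorbed by `isClosed_pointDeriv`. -/
theorem clDeriv_subset_preimage_pointDeriv (hφ : Continuous φ) {ε : ℝ} (hε : 0 < ε)
    {A : Set T} {B : Set (WeakDual 𝕜 E)} (hB : IsClosed B) (h : A ⊆ φ ⁻¹' B) :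
    clDeriv (fun s t => normDist (φ s) (φ t)) ε A ⊆ φ ⁻¹' pointDeriv ε B := by
  rintro t ⟨-, ht⟩
  refine closure_minimal ?_ ((isClosed_pointDeriv ε B hB).preimage hφ) (ht.resolve_left hε.not_ge)
  rintro s ⟨hs, hs'⟩
  refine ⟨h hs, fun V hV => ?_⟩
  obtain ⟨y, hy, hd⟩ := hs' _ (hφ.continuousAt hV)
  have hsV : φ s ∈ V := mem_of_mem_nhds hV
  calc ENNReal.ofReal ε < ENNReal.ofReal (normDist (φ s) (φ y)) :=
        (ENNReal.ofReal_lt_ofReal_iff_of_nonneg hε.le).2 hd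
    _ = edist (WeakDual.toStrongDual (φ s)) (WeakDual.toStrongDual (φ y)) := by
        rw [edist_dist, dist_eq_norm, normDist]
    _ ≤ Metric.ediam (WeakDual.toStrongDual '' (V ∩ B)) :=
        Metric.edist_le_ediam_of_mem (mem_image_of_mem _ ⟨hsV, h hs⟩)
          (mem_image_of_mem _ ⟨hy.1, h hy.2⟩)

theorem transIter_subset_preimage (hφ : Continuous φ) {ε : ℝ} (hε : 0 < ε) (ζ : Ordinal)
    {A : Set T} {B : Set (WeakDual 𝕜 E)} (hB : IsClosed B) (h : A ⊆ φ ⁻¹' B) :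
    transIter (clDeriv (fun s t => normDist (φ s) (φ t)) ε) ζ A ⊆
      φ ⁻¹' transIter (pointDeriv ε) ζ B := by
  induction ζ using Ordinal.limitRecOn with
  | zero => simpa using h
  | add_one ζ ih =>
    rw [transIter_add_one, transIter_add_one]
    exact clDeriv_subset_preimage_pointDeriv hφ hε
      (isClosed_transIter (isClosed_pointDeriv ε) ζ hB) ih
  | limit ζ hζ ih =>
    rw [transIter_limit _ hζ, transIter_limit _ hζ, preimage_iInter₂]
    exact iInter₂_mono ih

theorem listDeriv_subset_preimage (hφ : Continuous φ) (ξ : Ordinal) (l : List ℝ)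
    {A : Set T} {B : Set (WeakDual 𝕜 E)} (hB : IsClosed B) (h : A ⊆ φ ⁻¹' B) :
    IsClosed (multiDeriv ξ l B) ∧
      listDeriv (fun s t => normDist (φ s) (φ t)) ξ l A ⊆ φ ⁻¹' multiDeriv ξ l B := by
  induction l with
  | nil => exact ⟨hB, h⟩
  | cons ε l ih =>
    rw [listDeriv_cons]
    change IsClosed (iterDeriv ε (ω ^ ξ) (multiDeriv ξ l B)) ∧
      _ ⊆ φ ⁻¹' iterDeriv ε (ω ^ ξ) (multiDeriv ξ l B)
    rcases le_or_gt ε 0 with hε | hε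
    · rw [iterDeriv, if_pos hε, powDeriv_of_nonpos ξ hε]
      exact ih
    · rw [iterDeriv_of_pos hε]
      exact ⟨isClosed_transIter (isClosed_pointDeriv ε) _ ih.1,
        transIter_subset_preimage hφ hε _ ih.1 ih.2⟩

end Comparison

/-! ### From summability on `T` to summability on the hull -/

section Summability

variable {𝕜 : Type*} [RCLike 𝕜] {E : Type*} [NormedAddCommGroup E] [NormedSpace 𝕜 E]
variable {T : Type*}

/-- Otherwise some constant `c < r` dominates the function; test with `u = 0`. -/
theorem exists_nonempty_of_mem_envelope {Φ : T → WeakDual 𝕜 E} {S : Set (Set T × ℝ)}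
    (hS : S.Finite) {r : ℝ} {x : WeakDual 𝕜 E} (hx : x ∈ envelope Φ S r) :
    ∃ p ∈ S, p.1.Nonempty ∧ r ≤ p.2 := by
  by_contra! hcon
  have hev : ∀ᶠ c in 𝓝[<] r, ∀ p ∈ S, p.1.Nonempty → p.2 ≤ c := by
    refine (eventually_all_finite hS).2 fun p hp => ?_
    by_cases hne : p.1.Nonempty
    · filter_upwards [Ioo_mem_nhdsLT (hcon p hp hne)] with c hc _
      exact hc.1.le
    · exact Eventually.of_forall fun c h => absurd h hne
  obtain ⟨c, hc, hcr⟩ := (hev.and self_mem_nhdsWithin).exists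
  have := hx 0 c fun p hp t ht => by simpa using hc p hp ⟨t, ht⟩
  simp only [map_zero, zero_add] at this
  exact this.not_gt hcr

/-- A Young-type inequality, by comparing `8 b` with `ε`. The coefficient `1 / 8` is half of the
gain `1 / 4`, so this term can be absorbed. -/
theorem rpow_sub_one_mul_le {q : ℝ} (hq : 1 ≤ q) {ε b : ℝ} (hε : 0 ≤ ε) (hb : 0 ≤ b) :
    ε ^ (q - 1) * b ≤ 1 / 8 * ε ^ q + 8 ^ (q - 1) * b ^ q := by
  have hpow : ∀ x : ℝ, 0 ≤ x → x ^ (q - 1) * x = x ^ q := by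
    intro x hx
    rw [← Real.rpow_add_one' hx (by linarith), sub_add_cancel]
  have h₁ : 0 ≤ ε ^ q := Real.rpow_nonneg hε q
  have h₂ : 0 ≤ (8 : ℝ) ^ (q - 1) * b ^ q := by positivity
  rcases le_total (8 * b) ε with h | h
  · have : ε ^ (q - 1) * b ≤ ε ^ (q - 1) * (1 / 8 * ε) := by
      gcongr
      linarith
    rw [mul_left_comm, hpow ε hε] at this
    linarith
  · have : ε ^ (q - 1) * b ≤ (8 * b) ^ (q - 1) * b := by gcongr
    rw [Real.mul_rpow (by norm_num) hb, mul_assoc, hpow b hb] at this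
    linarith

variable [TopologicalSpace T] [CompactSpace T] {d : T → T → ℝ} {Φ : T → WeakDual 𝕜 E}

/-- Each entry uses `powDeriv_envelope` with `a = ε ^ (q - 1)` at level `ε / 2`, whence the gain `ε
^ q / 4` up to the mesh error. -/
theorem exists_listDeriv_subset_envelope (hΦ : Continuous Φ)
    (hd : ∀ s t, normDist (Φ s) (Φ t) ≤ d s t) {R : ℝ} (hR : ∀ s t, d s t ≤ R)
    (ξ : Ordinal) {q : ℝ} (hq : 1 ≤ q) {C : Set (WeakDual 𝕜 E)}
    (hC : C ⊆ envelope Φ {(univ, 0)} 0) {δ : ℝ} (hδ : 0 < δ) (l : List ℝ)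
    (hl : ∀ ε ∈ l, 0 ≤ ε) :
    ∃ S : Set (Set T × ℝ), S.Finite ∧
      listDeriv normDist ξ (l.map fun ε => ε / 2) C ⊆ envelope Φ S
        (1 / 4 * (l.map fun ε => ε ^ q).sum - 2 * δ * (l.map fun ε => ε ^ (q - 1)).sum) ∧
      ∀ p ∈ S, ∃ bs : List ℝ, (∀ b ∈ bs, 0 ≤ b) ∧ p.1 = listDeriv d ξ bs univ ∧
        p.2 ≤ 1 / 8 * (l.map fun ε => ε ^ q).sum + 8 ^ (q - 1) * (bs.map fun b => b ^ q).sum := by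
  induction l with
  | nil =>
    refine ⟨{(univ, 0)}, finite_singleton _, by simpa [listDeriv] using hC, ?_⟩
    rintro _ rfl
    exact ⟨[], by simp [listDeriv]⟩
  | cons ε l ih =>
    obtain ⟨S, hS, hsub, hbs⟩ := ih fun b hb => hl b (List.mem_cons_of_mem _ hb)
    have hε := hl ε List.mem_cons_self
    obtain ⟨J, hJ⟩ := exists_nat_ge (R / δ)
    have hJ' : ∀ s t, d s t ≤ J * δ := fun s t => (hR s t).trans ((div_le_iff₀ hδ).1 hJ)
    have hS' : ∀ p ∈ S, IsClosed p.1 := by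
      intro p hp
      obtain ⟨bs, -, h, -⟩ := hbs p hp
      rw [h]
      exact isClosed_listDeriv ξ bs isClosed_univ
    refine ⟨shift d ξ (ε ^ (q - 1)) δ J S, finite_shift _ _ _ _ hS, ?_, ?_⟩
    · rw [List.map_cons, listDeriv_cons]
      refine (powDeriv_mono ξ le_rfl hsub).trans ((powDeriv_envelope hΦ hd (ε / 2) ξ
        (Real.rpow_nonneg hε _) hδ hJ' hS hS' _).trans (envelope_anti _ (le_of_eq ?_)))
      have : ε ^ (q - 1) * ε = ε ^ q := by
        rw [← Real.rpow_add_one' hε (by linarith), sub_add_cancel]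
      simp only [List.map_cons, List.sum_cons]
      linear_combination (-1 / 4) * this
    · rintro _ ⟨p, hp, j, -, rfl⟩
      obtain ⟨bs, hbs0, h₁, h₂⟩ := hbs p hp
      have hj : 0 ≤ (j : ℝ) * δ := by positivity
      refine ⟨(j * δ) :: bs, ?_, ?_, ?_⟩
      · simpa using ⟨hj, hbs0⟩
      · simp only [h₁, listDeriv_cons]
      · have := rpow_sub_one_mul_le hq hε hj
        simp only [List.map_cons, List.sum_cons]
        linarith

theorem sum_rpow_le_of_multiDeriv_nonempty (hΦ : Continuous Φ)
    (hd : ∀ s t, normDist (Φ s) (Φ t) ≤ d s t) {R : ℝ} (hR : ∀ s t, d s t ≤ R)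
    (ξ : Ordinal) {q : ℝ} (hq : 1 ≤ q) {C : Set (WeakDual 𝕜 E)}
    (hC : C ⊆ envelope Φ {(univ, 0)} 0) {B : ℝ}
    (hB : ∀ bs : List ℝ, (∀ b ∈ bs, 0 ≤ b) → (listDeriv d ξ bs univ).Nonempty →
      (bs.map fun b => b ^ q).sum ≤ B)
    (l : List ℝ) (hl : ∀ ε ∈ l, 0 ≤ ε) (hne : (multiDeriv ξ l C).Nonempty) :
    (l.map fun ε => ε ^ q).sum ≤ 8 ^ q * B := by
  obtain ⟨x, hx⟩ := hne
  replace hx := multiDeriv_subset_listDeriv ξ l C hx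
  set s := (l.map fun ε => ε ^ q).sum
  set s' := (l.map fun ε => ε ^ (q - 1)).sum
  have hs' : 0 ≤ s' := List.sum_nonneg (by
    simp only [List.mem_map]
    rintro _ ⟨ε, hε, rfl⟩
    exact Real.rpow_nonneg (hl ε hε) _)
  have key : ∀ δ : ℝ, 0 < δ → s ≤ 8 ^ q * B + 16 * δ * s' := by
    intro δ hδ
    obtain ⟨S, hS, hsub, hbs⟩ := exists_listDeriv_subset_envelope hΦ hd hR ξ hq hC hδ l hl
    obtain ⟨p, hp, hpne, hr⟩ := exists_nonempty_of_mem_envelope hS (hsub hx)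
    obtain ⟨bs, hbs0, h₁, h₂⟩ := hbs p hp
    rw [h₁] at hpne
    have h₃ : (8 : ℝ) ^ (q - 1) * (bs.map fun b => b ^ q).sum ≤ 8 ^ (q - 1) * B := by
      gcongr
      exact hB bs hbs0 hpne
    have h₄ : (8 : ℝ) ^ (q - 1) * 8 = 8 ^ q := by
      rw [← Real.rpow_add_one' (by norm_num) (by linarith), sub_add_cancel]
    rw [← h₄]
    linarith
  refine le_of_forall_pos_le_add fun η hη => (key (η / (16 * (s' + 1))) (by positivity)).trans ?_
  have : 16 * (η / (16 * (s' + 1))) * s' = η * (s' / (s' + 1)) := by field_simp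
  rw [this]
  have : s' / (s' + 1) ≤ 1 := (div_le_one (by positivity)).2 (by linarith)
  nlinarith

end Summability

/-! ### Dual balls and the injective tensor product -/

section TensorProduct

variable {𝕜 : Type*} [RCLike 𝕜]

section DualBall

variable {X Y : Type*} [NormedAddCommGroup X] [NormedSpace 𝕜 X]
  [NormedAddCommGroup Y] [NormedSpace 𝕜 Y]

variable (𝕜 Y) in
/-- The closed unit ball of the dual space, with the weak* topology. -/
abbrev DualBall : Type _ :=
  ((WeakDual.toStrongDual : WeakDual 𝕜 Y ≃ₗ[𝕜] StrongDual 𝕜 Y) ⁻¹' Metric.closedBall 0 1 :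
    Set (WeakDual 𝕜 Y))

instance : CompactSpace (DualBall 𝕜 Y) :=
  isCompact_iff_compactSpace.1 (WeakDual.isCompact_closedBall 0 1)

/-- The adjoint of `A`, on the dual ball. -/
noncomputable def adjointMap (A : X →L[𝕜] Y) (y : DualBall 𝕜 Y) : WeakDual 𝕜 X :=
  StrongDual.toWeakDual ((WeakDual.toStrongDual y.1).comp A)

theorem DualBall.norm_le (y : DualBall 𝕜 Y) : ‖WeakDual.toStrongDual y.1‖ ≤ 1 :=
  mem_closedBall_zero_iff.1 y.2

theorem continuous_adjointMap (A : X →L[𝕜] Y) : Continuous (adjointMap A) :=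
  WeakDual.continuous_of_continuous_eval fun x =>
    (WeakDual.eval_continuous (A x)).comp continuous_subtype_val

theorem range_adjointMap (A : X →L[𝕜] Y) : range (adjointMap A) = adjointBall A := by
  ext x
  constructor
  · rintro ⟨y, rfl⟩
    exact ⟨_, y.2, rfl⟩
  · rintro ⟨y, hy, rfl⟩
    exact ⟨⟨StrongDual.toWeakDual y, hy⟩, rfl⟩

theorem isClosed_adjointBall (A : X →L[𝕜] Y) : IsClosed (adjointBall A) := by
  rw [← range_adjointMap]
  exact (isCompact_range (continuous_adjointMap A)).isClosed

theorem norm_toStrongDual_adjointMap_le (A : X →L[𝕜] Y) (y : DualBall 𝕜 Y) :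
    ‖WeakDual.toStrongDual (adjointMap A y)‖ ≤ ‖A‖ :=
  (ContinuousLinearMap.opNorm_comp_le (WeakDual.toStrongDual y.1) A).trans
    (mul_le_of_le_one_left (norm_nonneg _) y.norm_le)

theorem normDist_adjointMap_le (A : X →L[𝕜] Y) (y z : DualBall 𝕜 Y) :
    normDist (adjointMap A y) (adjointMap A z) ≤ 2 * ‖A‖ :=
  (norm_sub_le _ _).trans (by
    linarith [norm_toStrongDual_adjointMap_le A y, norm_toStrongDual_adjointMap_le A z])

theorem sum_rpow_le_of_listDeriv_nonempty {A : X →L[𝕜] Y} {M : ℝ} {ξ : Ordinal} {q : ℝ}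
    (h : SetSummableWith M ξ q (adjointBall A)) (l : List ℝ) (hl : ∀ ε ∈ l, 0 ≤ ε)
    (hne : (listDeriv (fun s t => normDist (adjointMap A s) (adjointMap A t)) ξ l
      univ).Nonempty) : (l.map fun ε => ε ^ q).sum ≤ M ^ q := by
  obtain ⟨t, ht⟩ := hne
  refine h l hl ⟨adjointMap A t, (listDeriv_subset_preimage (continuous_adjointMap A) ξ l
    (isClosed_adjointBall A) (fun s _ => ?_)).2 ht⟩
  rw [mem_preimage, ← range_adjointMap]
  exact mem_range_self s

end DualBall

variable {X₀ X₁ Y₀ Y₁ : Type*}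
  [NormedAddCommGroup X₀] [NormedSpace 𝕜 X₀] [NormedAddCommGroup X₁] [NormedSpace 𝕜 X₁]
  [NormedAddCommGroup Y₀] [NormedSpace 𝕜 Y₀] [NormedAddCommGroup Y₁] [NormedSpace 𝕜 Y₁]

/-- The functional `u ↦ y₀ (A₀ u A₁^* y₁)` on the injective tensor product. -/
noncomputable def tensorMap (A₀ : X₀ →L[𝕜] Y₀) (A₁ : X₁ →L[𝕜] Y₁) (t : DualBall 𝕜 Y₀ × DualBall 𝕜 Y₁) :
    WeakDual 𝕜 (InjTensor 𝕜 X₀ X₁) :=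
  StrongDual.toWeakDual ((WeakDual.toStrongDual (adjointMap A₀ t.1)).comp
    ((ContinuousLinearMap.apply 𝕜 X₀ (WeakDual.toStrongDual (adjointMap A₁ t.2))).comp
      (InjTensor 𝕜 X₀ X₁).subtypeL))

theorem tensorMap_apply (A₀ : X₀ →L[𝕜] Y₀) (A₁ : X₁ →L[𝕜] Y₁)
    (t : DualBall 𝕜 Y₀ × DualBall 𝕜 Y₁) (u : InjTensor 𝕜 X₀ X₁) :
    tensorMap A₀ A₁ t u = WeakDual.toStrongDual (adjointMap A₀ t.1)
      (u.1 (WeakDual.toStrongDual (adjointMap A₁ t.2))) := rfl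

/-- An elementary tensor gives a product of two evaluations. Any other `u` gives a uniform limit of
sums of these on the dual balls; this is where membership in the closed span matters. -/
theorem continuous_tensorMap (A₀ : X₀ →L[𝕜] Y₀) (A₁ : X₁ →L[𝕜] Y₁) :
    Continuous (tensorMap A₀ A₁) := by
  let f : Op 𝕜 (StrongDual 𝕜 X₁) X₀ → DualBall 𝕜 Y₀ × DualBall 𝕜 Y₁ → 𝕜 := fun u t =>
    WeakDual.toStrongDual (adjointMap A₀ t.1) (u (WeakDual.toStrongDual (adjointMap A₁ t.2)))
  have hspan : ∀ u ∈ Submodule.span 𝕜 (Set.range fun p : X₀ × X₁ => elemTensor (𝕜 := 𝕜) p.1 p.2),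
      Continuous (f u) := by
    intro u hu
    induction hu using Submodule.span_induction with
    | mem u hu =>
      obtain ⟨⟨x, y⟩, rfl⟩ := hu
      have : f (elemTensor x y) = fun t => adjointMap A₁ t.2 y * adjointMap A₀ t.1 x := by
        funext t
        simp only [f, elemTensor_apply, map_smul, smul_eq_mul]
        rfl
      simp only [this]
      exact ((WeakDual.eval_continuous y).comp ((continuous_adjointMap A₁).comp
        continuous_snd)).mul ((WeakDual.eval_continuous x).comp
          ((continuous_adjointMap A₀).comp continuous_fst))
    | zero => simpa [f] using continuous_const
    | add u v _ _ hu hv => simpa [f, Pi.add_def] using hu.add hv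
    | smul c u _ hu => simpa [f] using hu.const_mul c
  refine WeakDual.continuous_of_continuous_eval fun u => ?_
  change Continuous (f u.1)
  refine continuous_of_uniform_approx_of_continuous fun V hV => ?_
  obtain ⟨η, hη, hV⟩ := Metric.mem_uniformity_dist.1 hV
  have hpos : 0 < η / (‖A₀‖ * ‖A₁‖ + 1) := by positivity
  obtain ⟨v, hv, hd⟩ := Metric.mem_closure_iff.1 u.2 _ hpos
  refine ⟨f v, hspan v hv, fun t => hV ?_⟩
  have h₀ := norm_toStrongDual_adjointMap_le A₀ t.1
  have h₁ := norm_toStrongDual_adjointMap_le A₁ t.2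
  rw [dist_eq_norm] at hd ⊢
  have heq : f u.1 t - f v t = WeakDual.toStrongDual (adjointMap A₀ t.1)
      ((u.1 - v) (WeakDual.toStrongDual (adjointMap A₁ t.2))) := by
    simp [f]
  rw [heq]
  calc _ ≤ ‖A₀‖ * (‖u.1 - v‖ * ‖A₁‖) :=
        ContinuousLinearMap.le_of_opNorm_le_of_le _ h₀
          (ContinuousLinearMap.le_of_opNorm_le_of_le _ le_rfl h₁)
    _ = ‖u.1 - v‖ * (‖A₀‖ * ‖A₁‖) := by ring
    _ ≤ ‖u.1 - v‖ * (‖A₀‖ * ‖A₁‖ + 1) := by gcongr; linarith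
    _ < η := (lt_div_iff₀ (by positivity)).1 hd

theorem normDist_le_of_forall {E : Type*} [NormedAddCommGroup E] [NormedSpace 𝕜 E]
    {x y : WeakDual 𝕜 E} {C : ℝ} (hC : 0 ≤ C) (h : ∀ u, ‖x u - y u‖ ≤ C * ‖u‖) :
    normDist x y ≤ C :=
  ContinuousLinearMap.opNorm_le_bound _ hC h

theorem norm_apply_le_of_mem_adjointBall {X Y : Type*} [NormedAddCommGroup X]
    [NormedSpace 𝕜 X] [NormedAddCommGroup Y] [NormedSpace 𝕜 Y] {A : X →L[𝕜] Y}
    {x : WeakDual 𝕜 X} (hx : x ∈ adjointBall A) (u : X) : ‖x u‖ ≤ ‖A u‖ := by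
  obtain ⟨y, hy, rfl⟩ := hx
  exact (y.le_of_opNorm_le_of_le (mem_closedBall_zero_iff.1 hy) le_rfl).trans_eq (one_mul _)

/-- Change one coordinate at a time. The `+ 1` keeps the constant positive even when both operators
vanish. -/
theorem normDist_tensorMap_le (A₀ : X₀ →L[𝕜] Y₀) (A₁ : X₁ →L[𝕜] Y₁)
    (s t : DualBall 𝕜 Y₀ × DualBall 𝕜 Y₁) :
    normDist (𝕜 := 𝕜) (E := InjTensor 𝕜 X₀ X₁) (tensorMap A₀ A₁ s) (tensorMap A₀ A₁ t) ≤
      (‖A₀‖ + ‖A₁‖ + 1) * (normDist (adjointMap A₀ s.1) (adjointMap A₀ t.1) +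
        normDist (adjointMap A₁ s.2) (adjointMap A₁ t.2)) := by
  set d₀ := normDist (adjointMap A₀ s.1) (adjointMap A₀ t.1) with hd₀
  set d₁ := normDist (adjointMap A₁ s.2) (adjointMap A₁ t.2) with hd₁
  have p₀ : 0 ≤ d₀ := norm_nonneg _
  have p₁ : 0 ≤ d₁ := norm_nonneg _
  have n₀ := norm_nonneg A₀
  have n₁ := norm_nonneg A₁
  refine normDist_le_of_forall (by positivity) fun u => ?_
  have heq : tensorMap A₀ A₁ s u - tensorMap A₀ A₁ t u =
      (WeakDual.toStrongDual (adjointMap A₀ s.1) - WeakDual.toStrongDual (adjointMap A₀ t.1))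
        (u.1 (WeakDual.toStrongDual (adjointMap A₁ s.2))) +
      WeakDual.toStrongDual (adjointMap A₀ t.1)
        (u.1 (WeakDual.toStrongDual (adjointMap A₁ s.2) -
          WeakDual.toStrongDual (adjointMap A₁ t.2))) := by
    rw [tensorMap_apply, tensorMap_apply, map_sub, map_sub, sub_apply]
    ring
  rw [heq]
  have h₁ := norm_toStrongDual_adjointMap_le A₁ s.2
  have h₀ := norm_toStrongDual_adjointMap_le A₀ t.1
  have hu : ‖u.1‖ = ‖u‖ := rfl
  have e₀ := ContinuousLinearMap.le_of_opNorm_le_of_le (WeakDual.toStrongDual (adjointMap A₀ s.1)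
    - WeakDual.toStrongDual (adjointMap A₀ t.1)) hd₀.ge
    (ContinuousLinearMap.le_of_opNorm_le_of_le u.1 hu.le h₁)
  have e₁ := ContinuousLinearMap.le_of_opNorm_le_of_le (WeakDual.toStrongDual (adjointMap A₀ t.1))
    h₀ (ContinuousLinearMap.le_of_opNorm_le_of_le u.1 hu.le hd₁.ge)
  refine (norm_add_le_of_le e₀ e₁).trans ?_
  have hu0 := norm_nonneg u
  have : (‖A₀‖ + ‖A₁‖ + 1) * (d₀ + d₁) * ‖u‖ - (d₀ * (‖u‖ * ‖A₁‖) + ‖A₀‖ * (‖u‖ * d₁)) =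
      (‖A₀‖ + 1) * d₀ * ‖u‖ + (‖A₁‖ + 1) * d₁ * ‖u‖ := by ring
  have h' : 0 ≤ (‖A₀‖ + 1) * d₀ * ‖u‖ + (‖A₁‖ + 1) * d₁ * ‖u‖ := by positivity
  linarith

/-- The dual ball of the injective tensor product is generated by the elementary functionals. -/
theorem adjointBall_tensorOp_subset (A₀ : X₀ →L[𝕜] Y₀) (A₁ : X₁ →L[𝕜] Y₁) :
    adjointBall (tensorOp A₀ A₁) ⊆ envelope (tensorMap A₀ A₁) {(univ, 0)} 0 := by
  intro x hx u c hc
  have hc' : ∀ t, 0 ≤ re (tensorMap A₀ A₁ t u) + c := fun t => hc _ rfl t (mem_univ t)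
  have hbound : ∀ (y₀ : StrongDual 𝕜 Y₀) (y₁ : StrongDual 𝕜 Y₁), ‖y₀‖ ≤ 1 → ‖y₁‖ ≤ 1 →
      ‖y₀ (sandwich A₀ A₁ u.1 y₁)‖ ≤ c := by
    intro y₀ y₁ h₀ h₁
    -- Multiplying `y₀` by the unimodular scalar `-a` turns the value into minus its norm, so
    -- nonnegativity of the affine function bounds that norm by `c`.
    obtain ⟨a, ha, hmul⟩ := RCLike.exists_norm_eq_mul_self (y₀ (sandwich A₀ A₁ u.1 y₁))
    have ha' : ‖(-a) • y₀‖ ≤ 1 := by rw [norm_smul, norm_neg, ha, one_mul]; exact h₀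
    have h := hc' (⟨StrongDual.toWeakDual ((-a) • y₀), mem_closedBall_zero_iff.2 ha'⟩,
      ⟨StrongDual.toWeakDual y₁, mem_closedBall_zero_iff.2 h₁⟩)
    have heq : tensorMap A₀ A₁ (⟨StrongDual.toWeakDual ((-a) • y₀),
        mem_closedBall_zero_iff.2 ha'⟩, ⟨StrongDual.toWeakDual y₁,
        mem_closedBall_zero_iff.2 h₁⟩) u = -(a * y₀ (sandwich A₀ A₁ u.1 y₁)) := by
      rw [← neg_mul]
      rfl
    rw [heq, ← hmul, map_neg, RCLike.ofReal_re] at h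
    linarith
  have hc0 : 0 ≤ c := (norm_nonneg _).trans (hbound 0 0 (by simp) (by simp))
  have hnorm : ‖tensorOp A₀ A₁ u‖ ≤ c := by
    change ‖sandwich A₀ A₁ u.1‖ ≤ c
    by_contra! hlt
    obtain ⟨y₁, h₁, hy₁⟩ := ContinuousLinearMap.exists_lt_apply_of_lt_opNorm _ hlt
    obtain ⟨y₀, h₀, hy₀⟩ := exists_dual_vector'' 𝕜 (sandwich A₀ A₁ u.1 y₁)
    have h := hbound y₀ y₁ h₀ h₁.le
    rw [hy₀, RCLike.norm_ofReal, abs_norm] at h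
    exact h.not_gt hy₁
  have h := (norm_apply_le_of_mem_adjointBall hx u).trans hnorm
  have h' := (abs_le.1 ((RCLike.abs_re_le_norm _).trans h)).1
  linarith

/-- The summability of the Szlenk index passes to injective tensor products of operators. -/
theorem operatorSummable_tensorOp (ξ : Ordinal) {q : ℝ} (hq : 1 ≤ q)
    {A₀ : X₀ →L[𝕜] Y₀} {A₁ : X₁ →L[𝕜] Y₁} (h₀ : OperatorSummable ξ q A₀)
    (h₁ : OperatorSummable ξ q A₁) : OperatorSummable ξ q (tensorOp A₀ A₁) := by
  obtain ⟨M₀, hM₀, h₀⟩ := h₀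
  obtain ⟨M₁, hM₁, h₁⟩ := h₁
  set κ : ℝ := ‖A₀‖ + ‖A₁‖ + 1 with hκ
  have hκ0 : 0 < κ := by positivity
  have hq0 : q ≠ 0 := by linarith
  set B : ℝ := (2 * κ) ^ q * (M₀ ^ q + M₁ ^ q) with hB
  have hB0 : 0 ≤ B := by positivity
  refine ⟨(8 ^ q * B) ^ q⁻¹, by positivity, fun l hl hne => ?_⟩
  rw [Real.rpow_inv_rpow (by positivity) hq0]
  refine sum_rpow_le_of_multiDeriv_nonempty (R := κ * (2 * ‖A₀‖ + 2 * ‖A₁‖))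
    (continuous_tensorMap A₀ A₁) (normDist_tensorMap_le A₀ A₁) (fun s t => ?_) ξ hq
    (adjointBall_tensorOp_subset A₀ A₁) (fun bs hbs hne => ?_) l hl hne
  · have e₀ := normDist_adjointMap_le A₀ s.1 t.1
    have e₁ := normDist_adjointMap_le A₁ s.2 t.2
    rw [← hκ]
    gcongr
  · obtain ⟨p, hp⟩ := hne
    rw [← univ_prod_univ] at hp
    obtain ⟨l₀, l₁, hl₀, hl₁, hsum, hp₀, hp₁⟩ := listDeriv_prod
      (d₀ := fun s t => normDist (adjointMap A₀ s) (adjointMap A₀ t))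
      (d₁ := fun s t => normDist (adjointMap A₁ s) (adjointMap A₁ t))
      hκ0 ξ (fun b => b ^ q) bs hbs isClosed_univ isClosed_univ p hp
    have b₀ := sum_rpow_le_of_listDeriv_nonempty h₀ l₀ hl₀ ⟨_, hp₀⟩
    have b₁ := sum_rpow_le_of_listDeriv_nonempty h₁ l₁ hl₁ ⟨_, hp₁⟩
    have heq : (bs.map fun b => b ^ q).sum =
        (2 * κ) ^ q * (bs.map fun b => (b / (2 * κ)) ^ q).sum := by
      rw [← List.sum_map_mul_left]
      congr 1
      refine List.map_congr_left fun b hb => ?_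
      rw [← Real.mul_rpow (by positivity) (div_nonneg (hbs b hb) (by positivity)),
        mul_div_cancel₀ _ (by positivity)]
    rw [heq, hsum, hB]
    gcongr

end TensorProduct

end Szlenk

theorem mainTheorem6 {𝕜 : Type*} [RCLike 𝕜]
    {X₀ X₁ Y₀ Y₁ : Type*}
    [NormedAddCommGroup X₀] [NormedSpace 𝕜 X₀] [CompleteSpace X₀]
    [NormedAddCommGroup X₁] [NormedSpace 𝕜 X₁] [CompleteSpace X₁]
    [NormedAddCommGroup Y₀] [NormedSpace 𝕜 Y₀] [CompleteSpace Y₀]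
    [NormedAddCommGroup Y₁] [NormedSpace 𝕜 Y₁] [CompleteSpace Y₁]
    (ξ : Ordinal) (q : ℝ) (hq : 1 ≤ q)
    (A₀ : X₀ →L[𝕜] Y₀) (A₁ : X₁ →L[𝕜] Y₁)
    (h₀ : Szlenk.OperatorSummable ξ q A₀) (h₁ : Szlenk.OperatorSummable ξ q A₁) :
    Szlenk.OperatorSummable ξ q (Szlenk.tensorOp A₀ A₁) :=
  Szlenk.operatorSummable_tensorOp ξ hq h₀ h₁
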